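/- **Notation.** Let $S^2\subset\mathbb R^3$ be the unit sphere, $N=(0,0,1)$, $S=(0,0,-1)$, and use the first two Cartesian coordinates $(x,y)$ as local coordinates on $S^2$ near $N$ and near $S$. Let $T^2=\mathbb R^2/\mathbb Z^2$. Let $A=R_a\circ h_\alpha$ and $B=R_b\circ h_\beta$ be conformal linear maps of $\mathbb R^2$ (rotation of angle $a$, resp. $b$, in $[0,2\pi)$, composed with the homothety of ratio $\alpha>0$, resp. $\beta>0$, different from $1$). For $C=R_c\circ h_\gamma$ of this kind and $n\in\mathbb Z$ put $$Z=2\pi\Big(x\frac{\partial}{\partial y}-y\frac{\partial}{\partial x}\Big),\qquad X_{C,n}=\ln\gamma\,\Big(x\frac{\partial}{\partial x}+y\frac{\partial}{\partial y}\Big)+(c+2\pi n)\Big(x\frac{\partial}{\partial y}-y\frac{\partial}{\partial x}\Big).$$ These fields are invariant under $C$, and there is a diffeomorphism $\mathcal L_{C,n}$ from the orbit torus $T_C=(\mathbb R^2\setminus\{0\})/C$ to $T^2$, unique up to translations of $T^2$, which sends $Z$ to $\partial/\partial x$ and $X_{C,n}$ to $\partial/\partial y$; normalize it by $\mathcal L_{C,n}([(1,0)])=0$.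 Let $D_{A,B}$ be the set of $C^1$ diffeomorphisms $f$ of $S^2$ whose nonwandering set is $\{N,S\}$, where $N$ is a hyperbolic fixed source and $S$ a hyperbolic fixed sink, such that $D_Nf$ and $D_Sf$ each have a non-real eigenvalue, and whose expression in the coordinates $(x,y)$ is $A$ near $N$ and $B$ near $S$. For $f\in D_{A,B}$, let $T_f=(S^2\setminus\{N,S\})/f$ be the orbit torus. Since every orbit in $S^2\setminus\{N,S\}$ comes from $N$ and goes to $S$, the coordinates near $N$ and near $S$ induce diffeomorphisms $\pi_N:T_f\to T_A$ and $\pi_S:T_f\to T_B$. For $n\in\mathbb Z$, let $D_{A,B,n}$ be the set of $f\in D_{A,B}$ such that $\mathcal L_{B,0}\circ\pi_S\circ\pi_N^{-1}\circ\mathcal L_{A,0}^{-1}$ is isotopic to the linear map of $T^2$ induced by $\begin{pmatrix}1&n\\0&1\end{pmatrix}$. The Mather invariant of $f\in D_{A,B,n}$ is $\Delta_f=\mathcal L_{B,n}\circ\pi_S\circ\pi_N^{-1}\circ\mathcal L_{A,0}^{-1}:T^2\to T^2$. For $1\le r\le\infty$ let $C^r(f)=\{g\in\mathrm{Diff}^r(S^2):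 fg=gf\}$. **Theorem.** Let $f\in D_{A,B,n}$ be a $C^\infty$ diffeomorphism such that $\Delta_f$ is a translation of $T^2$. Then $f$ leaves invariant two commuting $C^\infty$ vector fields $Z_f$ and $X_f$ on $S^2$, linearly independent at every point of $S^2\setminus\{N,S\}$, such that, in the coordinates $(x,y)$, $Z_f=Z$ near $N$ and near $S$, $X_f=X_{A,0}$ near $N$, and $X_f=X_{B,n}$ near $S$. Consequently, for every $1\le r\le\infty$ the centralizer $C^r(f)$ is isomorphic to $S^1\times\mathbb R$; more precisely, writing $Z_f^s$ and $X_f^t$ for the flows of $Z_f$ and $X_f$, the map $(e^{2\pi i s},t)\mapsto Z_f^s\circ X_f^t$ is a group isomorphism from $S^1\times\mathbb R$ onto $C^r(f)$. -/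

import Mathlib

open scoped Manifold ContDiff Topology
open Filter

namespace MatherSphere

noncomputable section

/-! ## The sphere, its poles, and the coordinates `(x, y)` -/

/-- The unit sphere of `ℝ³`, with Mathlib's smooth structure. -/
abbrev S2 : Type := Metric.sphere (0 : EuclideanSpace ℝ (Fin 3)) 1

/-- The north pole `(0, 0, 1)`. -/
def north : S2 := ⟨EuclideanSpace.single 2 1, by simp⟩

/-- The south pole `(0, 0, -1)`. -/
def south : S2 := ⟨EuclideanSpace.single 2 (-1), by simp⟩

/-- The functions `(x, y)` on the sphere, with values in `ℝ² = ℂ`. They are local coordinates on a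
neighbourhood of each pole; on the sphere they vanish simultaneously only at the two poles. -/
def xy (p : S2) : ℂ := ⟨p.1 0, p.1 1⟩

/-! ## Diffeomorphisms and centralizers -/

/-- The group `Diff^r(S²)` of diffeomorphisms of class `C^r`. -/
def diffGroup (r : ℕ∞) : Subgroup (Equiv.Perm S2) where
  carrier := {g | ContMDiff (𝓡 2) (𝓡 2) r g ∧ ContMDiff (𝓡 2) (𝓡 2) r g.symm}
  one_mem' := ⟨contMDiff_id, contMDiff_id⟩
  mul_mem' := fun ha hb => ⟨ha.1.comp hb.1, hb.2.comp ha.2⟩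
  inv_mem' := fun ha => ⟨ha.2, ha.1⟩

/-- The centralizer `C(f) = {g ∈ Diff^r(S²) : f g = g f}`. -/
def diffCentralizer (r : ℕ∞) (f : Equiv.Perm S2) : Subgroup (Equiv.Perm S2) :=
  diffGroup r ⊓ Subgroup.centralizer {f}

/-! ## North-south Morse-Smale diffeomorphisms -/

/-- The nonwandering set `Ω(f)`. -/
def nonwanderingSet (f : Equiv.Perm S2) : Set S2 :=
  {p | ∀ U ∈ 𝓝 p, ∃ m : ℕ, 1 ≤ m ∧ ((f ^ m) '' U ∩ U).Nonempty}

/-- The complex eigenvalues of the derivative `D_p f : T_p S² → T_p S²` at a fixed point `p`. -/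
def derivEigenvalues (f : Equiv.Perm S2) (p : S2) : Set ℂ :=
  let D : EuclideanSpace ℝ (Fin 2) →L[ℝ] EuclideanSpace ℝ (Fin 2) := mfderiv (𝓡 2) (𝓡 2) f p
  {μ | Polynomial.aeval μ (D : EuclideanSpace ℝ (Fin 2) →ₗ[ℝ] EuclideanSpace ℝ (Fin 2)).charpoly
    = 0}

/-- `f` is a `C¹` diffeomorphism of `S²` whose nonwandering set is `{Nf, Sf}`, where `Nf` is a
hyperbolic fixed source, `Sf` is a hyperbolic fixed sink, and the derivative at each of them has a
non-real eigenvalue. Such an `f` is automatically Morse-Smale: all intersections of stable and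
unstable manifolds are transverse, because `W^u(Nf)` and `W^s(Sf)` are open, while
`W^s(Nf) = {Nf}` and `W^u(Sf) = {Sf}`. -/
structure IsNorthSouth (f : Equiv.Perm S2) (Nf Sf : S2) : Prop where
  diffeo : f ∈ diffGroup 1
  ne : Nf ≠ Sf
  nonwandering : nonwanderingSet f = {Nf, Sf}
  fixed_source : f Nf = Nf
  fixed_sink : f Sf = Sf
  source : ∀ μ ∈ derivEigenvalues f Nf, 1 < ‖μ‖
  sink : ∀ μ ∈ derivEigenvalues f Sf, ‖μ‖ < 1
  source_nonreal : ∃ μ ∈ derivEigenvalues f Nf, μ.im ≠ 0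
  sink_nonreal : ∃ μ ∈ derivEigenvalues f Sf, μ.im ≠ 0

/-! ## Conformal linear maps of the plane and their orbit tori -/

/-- A conformal linear map `R_a ∘ h_α` of `ℝ² = ℂ`: the homothety of ratio `α ≠ 1` followed by the
rotation of angle `a ∈ [0, 2π)`. -/
structure Conformal where
  ratio : ℝ
  angle : ℝ
  ratio_pos : 0 < ratio
  ratio_ne_one : ratio ≠ 1
  angle_nonneg : 0 ≤ angle
  angle_lt : angle < 2 * Real.pi

/-- The complex number `α e^{ia}`; the conformal map is multiplication by it. -/
def Conformal.mult (A : Conformal) : ℂ := A.ratio * Complex.exp (A.angle * Complex.I)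

lemma Conformal.mult_ne_zero (A : Conformal) : A.mult ≠ 0 :=
  mul_ne_zero (by exact_mod_cast A.ratio_pos.ne') (Complex.exp_ne_zero _)

/-- `α e^{ia}` as an element of the multiplicative group `ℂˣ = ℝ² ∖ {0}`. -/
def Conformal.unit (A : Conformal) : ℂˣ := Units.mk0 A.mult A.mult_ne_zero

/-- The linear vector field `Z = 2π (x ∂/∂y - y ∂/∂x)`. -/
def fieldZ (w : ℂ) : ℂ := 2 * Real.pi * Complex.I * w

/-- The linear vector field
`X_{A,n} = ln α (x ∂/∂x + y ∂/∂y) + (a + 2πn) (x ∂/∂y - y ∂/∂x)`. -/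
def fieldX (A : Conformal) (n : ℤ) (w : ℂ) : ℂ :=
  (Real.log A.ratio + (A.angle + 2 * Real.pi * n) * Complex.I) * w

/-- The torus `T_A = (ℝ² ∖ {0}) / A` of orbits of `A`. As `A` is multiplication by an element of
`ℂˣ`, its orbits are the cosets of the subgroup generated by this element. -/
abbrev Conformal.Torus (A : Conformal) : Type := ℂˣ ⧸ Subgroup.zpowers A.unit

/-- The torus `T² = ℝ²/ℤ²`. -/
abbrev T2 : Type := AddCircle (1 : ℝ) × AddCircle (1 : ℝ)

/-- The map `ℝ² ∖ {0} → T²` which induces `L_{A,n}`: in terms of the flows of the commuting fields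
`Z` and `X_{A,n}`, it sends `Z^s (X_{A,n}^t (1, 0))` to the class of `(s, t)`. -/
def chartLift (A : Conformal) (n : ℤ) (w : ℂˣ) : T2 :=
  let t : ℝ := Real.log ‖(w : ℂ)‖ / Real.log A.ratio
  let s : ℝ := (Complex.arg w - (A.angle + 2 * Real.pi * n) * t) / (2 * Real.pi)
  (s, t)

/-- The time `s` map of the flow of `Z` followed by the time `t` map of the flow of `X_{A,n}`: both
are multiplications by complex numbers. -/
def flowUnit (A : Conformal) (n : ℤ) (s t : ℝ) : ℂˣ :=
  Units.mk0 (Complex.exp (((t * Real.log A.ratio : ℝ) : ℂ)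
    + ((2 * Real.pi * s + t * (A.angle + 2 * Real.pi * n) : ℝ) : ℂ) * Complex.I))
    (Complex.exp_ne_zero _)

lemma log_ratio_ne_zero (A : Conformal) : Real.log A.ratio ≠ 0 :=
  Real.log_ne_zero_of_pos_of_ne_one A.ratio_pos A.ratio_ne_one

lemma exists_arg_exp_mul (r θ : ℝ) (w : ℂ) (hw : w ≠ 0) :
    ∃ k : ℤ, Complex.arg (Complex.exp (r + θ * Complex.I) * w)
      = θ + Complex.arg w + 2 * Real.pi * k := by
  have h : ((Complex.arg (Complex.exp (r + θ * Complex.I) * w) : ℝ) : Real.Angle)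
      = ((θ + Complex.arg w : ℝ) : Real.Angle) := by
    rw [Complex.arg_mul_coe_angle (Complex.exp_ne_zero _) hw, Real.Angle.coe_add]
    congr 1
    rw [Complex.exp_add, ← Complex.ofReal_exp, Complex.arg_real_mul _ (Real.exp_pos r),
      Complex.exp_mul_I]
    simpa using Complex.arg_cos_add_sin_mul_I_coe_angle (θ : Real.Angle)
  obtain ⟨k, hk⟩ := Real.Angle.angle_eq_iff_two_pi_dvd_sub.1 h
  exact ⟨k, by linarith⟩

/-- The induced map carries `Z` to `∂/∂x` and `X_{A,n}` to `∂/∂y`. -/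
lemma chartLift_flow (A : Conformal) (n : ℤ) (s t : ℝ) (w : ℂˣ) :
    chartLift A n (flowUnit A n s t * w)
      = chartLift A n w + ((s : AddCircle (1 : ℝ)), (t : AddCircle (1 : ℝ))) := by
  obtain ⟨k, hk⟩ := exists_arg_exp_mul (t * Real.log A.ratio)
    (2 * Real.pi * s + t * (A.angle + 2 * Real.pi * n)) w w.ne_zero
  have hL := log_ratio_ne_zero A
  have hpi := Real.pi_ne_zero
  have hn : Real.log ‖((flowUnit A n s t * w : ℂˣ) : ℂ)‖
      = t * Real.log A.ratio + Real.log ‖(w : ℂ)‖ := by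
    simp only [flowUnit, Units.val_mul, Units.val_mk0, norm_mul]
    rw [Real.log_mul (by simp) (by simp), Complex.norm_exp]
    simp
  have ha : Complex.arg ((flowUnit A n s t * w : ℂˣ) : ℂ)
      = 2 * Real.pi * s + t * (A.angle + 2 * Real.pi * n) + Complex.arg w + 2 * Real.pi * k := by
    rw [← hk]; simp [flowUnit]
  simp only [chartLift, hn, ha]
  refine Prod.ext ?_ ?_
  · simp only [Prod.fst_add]
    rw [← AddCircle.coe_add, ← sub_eq_zero, ← AddCircle.coe_sub, AddCircle.coe_eq_zero_iff]
    refine ⟨k, ?_⟩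
    simp only [zsmul_eq_mul, mul_one]
    field_simp
    ring
  · simp only [Prod.snd_add]
    rw [← AddCircle.coe_add]
    congr 1
    field_simp
    ring

lemma flowUnit_int (A : Conformal) (n l k : ℤ) : flowUnit A n l k = A.unit ^ k := by
  ext
  simp only [flowUnit, Conformal.unit, Conformal.mult, Units.val_mk0, Units.val_zpow_eq_zpow_val]
  have h : (A.ratio : ℂ) = Complex.exp (Real.log A.ratio : ℝ) := by
    rw [← Complex.ofReal_exp, Real.exp_log A.ratio_pos]
  rw [h, ← Complex.exp_add, ← Complex.exp_int_mul, Complex.exp_eq_exp_iff_exists_int]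
  refine ⟨l + k * n, ?_⟩
  push_cast
  ring

lemma flowUnit_mul (A : Conformal) (n : ℤ) (s t s' t' : ℝ) :
    flowUnit A n (s + s') (t + t') = flowUnit A n s t * flowUnit A n s' t' := by
  ext
  simp only [flowUnit, Units.val_mul, Units.val_mk0, ← Complex.exp_add]
  congr 1
  push_cast
  ring

lemma eq_flowUnit (A : Conformal) (n : ℤ) (w : ℂˣ) :
    w = flowUnit A n ((Complex.arg w - (A.angle + 2 * Real.pi * n)
      * (Real.log ‖(w : ℂ)‖ / Real.log A.ratio)) / (2 * Real.pi))
      (Real.log ‖(w : ℂ)‖ / Real.log A.ratio) := by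
  ext
  have hpi := Real.pi_ne_zero
  have h1 : Real.log ‖(w : ℂ)‖ / Real.log A.ratio * Real.log A.ratio = Real.log ‖(w : ℂ)‖ :=
    div_mul_cancel₀ _ (log_ratio_ne_zero A)
  simp only [flowUnit, Units.val_mk0]
  rw [h1, mul_div_cancel₀ _ (by positivity), Complex.exp_add, ← Complex.ofReal_exp,
    Real.exp_log (by simp), mul_comm (A.angle + 2 * Real.pi * n), sub_add_cancel,
    Complex.norm_mul_exp_arg_mul_I]

lemma chartLift_eq_iff (A : Conformal) (n : ℤ) (w w' : ℂˣ) :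
    chartLift A n w = chartLift A n w' ↔ w⁻¹ * w' ∈ Subgroup.zpowers A.unit := by
  constructor
  · intro h
    obtain ⟨h1, h2⟩ := Prod.ext_iff.1 h.symm
    simp only [chartLift] at h1 h2
    rw [← sub_eq_zero, ← AddCircle.coe_sub, AddCircle.coe_eq_zero_iff] at h1 h2
    obtain ⟨l, hl⟩ := h1
    obtain ⟨k, hk⟩ := h2
    simp only [zsmul_eq_mul, mul_one] at hl hk
    refine ⟨k, ?_⟩
    rw [eq_inv_mul_iff_mul_eq]
    change w * A.unit ^ k = w'
    conv_lhs => rw [eq_flowUnit A n w]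
    conv_rhs => rw [eq_flowUnit A n w']
    rw [← flowUnit_int A n l k, ← flowUnit_mul, hl, hk]
    congr 1 <;> ring
  · rintro ⟨k, hk⟩
    have hw : w' = flowUnit A n (0 : ℤ) k * w := by
      rw [flowUnit_int, mul_comm]
      exact (eq_inv_mul_iff_mul_eq.1 hk).symm
    rw [hw, chartLift_flow]
    refine Prod.ext ?_ ?_
    · simp
    · simp only [Prod.snd_add]
      rw [left_eq_add, AddCircle.coe_eq_zero_iff]
      exact ⟨k, by simp⟩

/-- The map `L_{A,n} : T_A → T²` carrying `Z` to `∂/∂x` and `X_{A,n}` to `∂/∂y`, normalized by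
`L_{A,n}([(1, 0)]) = 0`. (These properties determine it; without the normalization it is unique up
to a translation of `T²`.) -/
def chart (A : Conformal) (n : ℤ) : A.Torus ≃ T2 :=
  Equiv.ofBijective
    (Quotient.lift (chartLift A n)
      fun w w' h => (chartLift_eq_iff A n w w').2 (QuotientGroup.leftRel_apply.1 h))
    ⟨by
      rintro ⟨w⟩ ⟨w'⟩ h
      exact QuotientGroup.eq.2 ((chartLift_eq_iff A n w w').1 h), by
      rintro ⟨⟨s⟩, ⟨t⟩⟩
      refine ⟨QuotientGroup.mk (flowUnit A n s t * 1), (chartLift_flow A n s t 1).trans ?_⟩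
      refine Prod.ext ?_ ?_ <;> simp [chartLift] <;> rfl⟩

/-! ## The Mather invariant -/

/-- `D_{A,B}`: north-south diffeomorphisms with source `N` and sink `S` whose expression in the
coordinates `(x, y)` is the conformal map `A` near `N` and the conformal map `B` near `S`. -/
structure IsDAB (f : Equiv.Perm S2) (A B : Conformal) : Prop where
  northSouth : IsNorthSouth f north south
  near_north : ∀ᶠ p in 𝓝 north, xy (f p) = A.mult * xy p
  near_south : ∀ᶠ p in 𝓝 south, xy (f p) = B.mult * xy p

/-- Two points of `S² ∖ {N, S}` are equivalent when they lie in the same `f`-orbit. -/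
def orbitSetoid (f : Equiv.Perm S2) : Setoid {p : S2 // p ≠ north ∧ p ≠ south} :=
  (Equiv.Perm.SameCycle.setoid f).comap Subtype.val

/-- The torus `T_f = (S² ∖ {N, S}) / f` of orbits of `f`. -/
abbrev OrbitTorus (f : Equiv.Perm S2) : Type := Quotient (orbitSetoid f)

instance (f : Equiv.Perm S2) : Nonempty (OrbitTorus f) :=
  ⟨Quotient.mk _ ⟨⟨EuclideanSpace.single 0 1, by simp⟩, by
    constructor <;> intro h <;>
      simpa [north, south] using congrArg (fun q : S2 => q.1 2) h⟩⟩

/-- The map `T_f → T_C` sending the `f`-orbit of `p` to the eventual value of the sequence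
`[xy (g^m p)]` of points of `T_C`. It is used for `g = f⁻¹` (where `g^m p → N` and `f` is equal to
`C = A` near `N`) and for `g = f` (where `g^m p → S` and `f` is equal to `C = B` near `S`): this
sequence is then eventually constant, and its eventual value depends only on the orbit. -/
def endMap (f g : Equiv.Perm S2) (C : Conformal) (q : OrbitTorus f) : C.Torus :=
  Classical.epsilon fun c => ∀ p, Quotient.mk (orbitSetoid f) p = q →
    ∀ᶠ m : ℕ in atTop, ∃ w : ℂˣ, (w : ℂ) = xy ((g ^ m) p.1) ∧ (QuotientGroup.mk w : C.Torus) = c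

/-- The identification `π_N : T_f → T_A`. -/
def piNorth (f : Equiv.Perm S2) (A : Conformal) : OrbitTorus f → A.Torus := endMap f f⁻¹ A

/-- The identification `π_S : T_f → T_B`. -/
def piSouth (f : Equiv.Perm S2) (B : Conformal) : OrbitTorus f → B.Torus := endMap f f B

/-- The map `L_{B,n} ∘ π_S ∘ π_N⁻¹ ∘ L_{A,0}⁻¹` of `T²`. (For `f` in `D_{A,B}` the map `π_N` is a
bijection, so `Function.invFun` is its inverse.) -/
def torusMap (f : Equiv.Perm S2) (A B : Conformal) (n : ℤ) : T2 → T2 :=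
  chart B n ∘ piSouth f B ∘ Function.invFun (piNorth f A) ∘ (chart A 0).symm

/-- Isotopy of self-maps of `T²`. (For homeomorphisms of the torus, and for diffeomorphisms, this
is the same relation whether the isotopy is required to be smooth or only continuous.) -/
def Isotopic (F G : T2 → T2) : Prop :=
  ∃ H : unitInterval → (T2 ≃ₜ T2),
    Continuous (fun q : unitInterval × T2 => H q.1 q.2) ∧ ⇑(H 0) = F ∧ ⇑(H 1) = G

/-- The linear map of `T²` induced by the matrix with rows `(1, n)` and `(0, 1)`. -/
def shear (n : ℤ) (u : T2) : T2 := (u.1 + n • u.2, u.2)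

/-- `D_{A,B,n}`: the elements `f` of `D_{A,B}` with `n(f) = n`, that is, such that
`Δ_{f,0,0} = L_{B,0} ∘ π_S ∘ π_N⁻¹ ∘ L_{A,0}⁻¹` is isotopic to the linear map induced by the matrix
with rows `(1, n)` and `(0, 1)`. -/
structure IsDABn (f : Equiv.Perm S2) (A B : Conformal) (n : ℤ) : Prop where
  isDAB : IsDAB f A B
  isotopic : Isotopic (torusMap f A B 0) (shear n)

/-- The Mather invariant `Δ_f = L_{B,n} ∘ π_S ∘ π_N⁻¹ ∘ L_{A,0}⁻¹` of an element `f` of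
`D_{A,B,n}`. -/
def matherInvariant (f : Equiv.Perm S2) (A B : Conformal) (n : ℤ) : T2 → T2 := torusMap f A B n

/-- `F` is a translation of `T²`. -/
def IsTranslation (F : T2 → T2) : Prop := ∃ c : T2, ∀ u, F u = u + c

/-! ## Vector fields on the sphere -/

/-- `V` is a `C^∞` vector field on `S²`. -/
def SmoothField (V : (p : S2) → TangentSpace (𝓡 2) p) : Prop :=
  ContMDiff (𝓡 2) (𝓡 2).tangent ∞ (fun p => (⟨p, V p⟩ : TangentBundle (𝓡 2) S2))

/-- `f` leaves the vector field `V` invariant: `D_p f (V p) = V (f p)`. -/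
def Preserves (f : Equiv.Perm S2) (V : (p : S2) → TangentSpace (𝓡 2) p) : Prop :=
  ∀ p, mfderiv (𝓡 2) (𝓡 2) f p (V p) = V (f p)

/-- In a neighbourhood of `P`, the expression of `V` in the coordinates `(x, y)` is the vector field
`v` of the plane. -/
def AgreesNear (V : (p : S2) → TangentSpace (𝓡 2) p) (v : ℂ → ℂ) (P : S2) : Prop :=
  ∀ᶠ p in 𝓝 P, mfderiv (𝓡 2) 𝓘(ℝ, ℂ) xy p (V p) = v (xy p)

end

end MatherSphere

open MatherSphere

namespace MatherSphere

noncomputable section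

/-! ## The hemispheres as graphs over the disc -/

/-- Central projection of the plane at height `e = ±1` onto an open hemisphere. -/
def gnomonic (e : ℤˣ) (u : ℂ) : S2 :=
  ⟨(√(1 + u.re ^ 2 + u.im ^ 2))⁻¹ • !₂[u.re, u.im, ((e : ℤ) : ℝ)], by
    have h1 : (((e : ℤ) : ℝ)) ^ 2 = 1 := by
      rcases Int.units_eq_one_or e with rfl | rfl <;> norm_num
    have h : 0 < 1 + u.re ^ 2 + u.im ^ 2 := by positivity
    rw [mem_sphere_zero_iff_norm, norm_smul, EuclideanSpace.norm_eq, norm_inv,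
      Real.norm_of_nonneg (Real.sqrt_nonneg _)]
    simp only [Fin.sum_univ_three, Real.norm_eq_abs, sq_abs]
    simp only [Matrix.cons_val_zero, Matrix.cons_val_one, Matrix.cons_val, h1]
    rw [show u.re ^ 2 + u.im ^ 2 + 1 = 1 + u.re ^ 2 + u.im ^ 2 by ring]
    exact inv_mul_cancel₀ (Real.sqrt_pos.2 h).ne'⟩

lemma contMDiff_gnomonic (e : ℤˣ) : ContMDiff 𝓘(ℝ, ℂ) (𝓡 2) ∞ (gnomonic e) := by
  have : Fact (Module.finrank ℝ (EuclideanSpace ℝ (Fin 3)) = 2 + 1) :=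
    ⟨finrank_euclideanSpace_fin⟩
  refine ContMDiff.codRestrict_sphere (f := fun u : ℂ =>
    (√(1 + u.re ^ 2 + u.im ^ 2))⁻¹ • !₂[u.re, u.im, ((e : ℤ) : ℝ)]) ?_ _
  have hre : ContDiff ℝ ∞ Complex.re := Complex.reCLM.contDiff
  have him : ContDiff ℝ ∞ Complex.im := Complex.imCLM.contDiff
  have hp : ContDiff ℝ ∞ fun u : ℂ => 1 + u.re ^ 2 + u.im ^ 2 := by fun_prop
  refine ContDiff.contMDiff ?_
  refine ContDiff.smul ((hp.sqrt fun u => by positivity).inv fun u => ?_) ?_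
  · exact (Real.sqrt_pos.2 (by positivity)).ne'
  · rw [contDiff_euclidean]
    intro i
    fin_cases i
    · simpa using hre
    · simpa using him
    · simpa using contDiff_const

/-- The point of the open hemisphere around the pole `(0, 0, e)` with coordinates `(x, y) = w`. -/
def hemi (e : ℤˣ) (w : ℂ) : S2 := gnomonic e ((√(1 - ‖w‖ ^ 2))⁻¹ • w)

/-- The pole `(0, 0, e)`. -/
def pole (e : ℤˣ) : S2 := hemi e 0

lemma one_sub_norm_sq_pos {w : ℂ} (hw : ‖w‖ < 1) : 0 < 1 - ‖w‖ ^ 2 := by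
  nlinarith [norm_nonneg w]

lemma hemi_val (e : ℤˣ) {w : ℂ} (hw : ‖w‖ < 1) :
    (hemi e w).1 = !₂[w.re, w.im, ((e : ℤ) : ℝ) * √(1 - ‖w‖ ^ 2)] := by
  have h := one_sub_norm_sq_pos hw
  set r := √(1 - ‖w‖ ^ 2) with hr
  have hr0 : 0 < r := Real.sqrt_pos.2 h
  have hr2 : r ^ 2 = 1 - ‖w‖ ^ 2 := Real.sq_sqrt h.le
  have hn : ‖w‖ ^ 2 = w.re ^ 2 + w.im ^ 2 := by
    rw [← Complex.normSq_eq_norm_sq, Complex.normSq_apply]; ring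
  have key : √(1 + (r⁻¹ • w).re ^ 2 + (r⁻¹ • w).im ^ 2) = r⁻¹ := by
    rw [Real.sqrt_eq_iff_mul_self_eq (by positivity) (by positivity)]
    simp only [Complex.real_smul, Complex.re_ofReal_mul, Complex.im_ofReal_mul]
    field_simp
    linarith
  simp only [hemi, gnomonic, ← hr]
  rw [key, inv_inv]
  ext i
  fin_cases i <;> simp [mul_comm] <;> field_simp

lemma xy_hemi (e : ℤˣ) {w : ℂ} (hw : ‖w‖ < 1) : xy (hemi e w) = w := by
  apply Complex.ext <;> simp [xy, hemi_val e hw]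

lemma height_hemi_pos (e : ℤˣ) {w : ℂ} (hw : ‖w‖ < 1) :
    0 < ((e : ℤ) : ℝ) * (hemi e w).1 2 := by
  have h := Real.sqrt_pos.2 (one_sub_norm_sq_pos hw)
  rw [hemi_val e hw]
  rcases Int.units_eq_one_or e with rfl | rfl <;> simpa using h

lemma norm_xy_sq (p : S2) : ‖xy p‖ ^ 2 + p.1 2 ^ 2 = 1 := by
  have h : ‖p.1‖ ^ 2 = 1 := by rw [mem_sphere_zero_iff_norm.1 p.2, one_pow]
  rw [EuclideanSpace.norm_sq_eq, Fin.sum_univ_three] at h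
  simp only [Real.norm_eq_abs, sq_abs] at h
  rw [← Complex.normSq_eq_norm_sq, Complex.normSq_apply]
  simp only [xy]
  linarith

lemma norm_xy_lt_one {p : S2} (hp : p.1 2 ≠ 0) : ‖xy p‖ < 1 := by
  have := norm_xy_sq p
  have : 0 < p.1 2 ^ 2 := by positivity
  nlinarith [norm_nonneg (xy p)]

lemma hemi_xy {e : ℤˣ} {p : S2} (hp : 0 < ((e : ℤ) : ℝ) * p.1 2) : hemi e (xy p) = p := by
  have h0 : p.1 2 ≠ 0 := fun h => by simp [h] at hp
  have hw := norm_xy_lt_one h0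
  apply Subtype.ext
  rw [hemi_val e hw]
  have h2 : 1 - ‖xy p‖ ^ 2 = p.1 2 ^ 2 := by linarith [norm_xy_sq p]
  rw [h2, Real.sqrt_sq_eq_abs]
  ext i
  fin_cases i
  · simp [xy]
  · simp [xy]
  · rcases Int.units_eq_one_or e with rfl | rfl
    · have : 0 < p.1 2 := by simpa using hp
      simp [abs_of_pos this]
    · have : p.1 2 < 0 := by simpa using hp
      simp [abs_of_neg this]

lemma contMDiffAt_hemi (e : ℤˣ) {w : ℂ} (hw : ‖w‖ < 1) :
    ContMDiffAt 𝓘(ℝ, ℂ) (𝓡 2) ∞ (hemi e) w := by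
  have h := one_sub_norm_sq_pos hw
  refine (contMDiff_gnomonic e).contMDiffAt.comp w (ContDiffAt.contMDiffAt ?_)
  have h1 : ContDiffAt ℝ ∞ (fun w : ℂ => 1 - ‖w‖ ^ 2) w :=
    (contDiff_const.sub (contDiff_norm_sq ℝ)).contDiffAt
  exact ((h1.sqrt h.ne').inv (Real.sqrt_pos.2 h).ne').smul contDiffAt_id

lemma contMDiff_xy : ContMDiff (𝓡 2) 𝓘(ℝ, ℂ) ∞ xy := by
  have : Fact (Module.finrank ℝ (EuclideanSpace ℝ (Fin 3)) = 2 + 1) :=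
    ⟨finrank_euclideanSpace_fin⟩
  have h : ContMDiff (𝓡 2) 𝓘(ℝ, EuclideanSpace ℝ (Fin 3)) ∞ (fun p : S2 => p.1) :=
    contMDiff_coe_sphere
  have h2 : ContDiff ℝ ∞ fun v : EuclideanSpace ℝ (Fin 3) => v 0 • (1 : ℂ) + v 1 • Complex.I := by
    fun_prop
  convert! h2.contMDiff.comp h using 1
  funext p
  apply Complex.ext <;> simp [xy]

lemma continuous_xy : Continuous xy := contMDiff_xy.continuous

lemma pole_one : pole 1 = north := by
  apply Subtype.ext
  rw [pole, hemi_val 1 (by simp)]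
  ext i
  fin_cases i <;> simp [north]

lemma pole_neg_one : pole (-1) = south := by
  apply Subtype.ext
  rw [pole, hemi_val (-1) (by simp)]
  ext i
  fin_cases i <;> simp [south]

lemma xy_pole (e : ℤˣ) : xy (pole e) = 0 := xy_hemi e (by simp)

lemma continuous_height (e : ℤˣ) : Continuous fun p : S2 => ((e : ℤ) : ℝ) * p.1 2 := by
  fun_prop

lemma height_pole_pos (e : ℤˣ) : 0 < ((e : ℤ) : ℝ) * (pole e).1 2 := height_hemi_pos e (by simp)

lemma height_pole_neg (e : ℤˣ) : ((e : ℤ) : ℝ) * (pole (-e)).1 2 < 0 := by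
  have := height_pole_pos (-e)
  push_cast at this
  linarith

/-- The open spherical cap around the pole `(0, 0, e)` lying over the disc of radius `δ`. -/
def cap (e : ℤˣ) (δ : ℝ) : Set S2 := {p | 0 < ((e : ℤ) : ℝ) * p.1 2 ∧ ‖xy p‖ < δ}

lemma isOpen_cap (e : ℤˣ) (δ : ℝ) : IsOpen (cap e δ) :=
  (isOpen_lt continuous_const (continuous_height e)).inter
    (isOpen_lt continuous_xy.norm continuous_const)

lemma pole_mem_cap (e : ℤˣ) {δ : ℝ} (hδ : 0 < δ) : pole e ∈ cap e δ :=
  ⟨height_pole_pos e, by simpa [xy_pole] using hδ⟩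

lemma cap_mem_nhds (e : ℤˣ) {δ : ℝ} (hδ : 0 < δ) : cap e δ ∈ 𝓝 (pole e) :=
  (isOpen_cap e δ).mem_nhds (pole_mem_cap e hδ)

lemma continuousAt_hemi (e : ℤˣ) {w : ℂ} (hw : ‖w‖ < 1) : ContinuousAt (hemi e) w :=
  (contMDiffAt_hemi e hw).continuousAt

/-! ## Linearizable fixed points -/

/-- On the cap of radius `δ` around the pole `(0, 0, e)` the map `F` is multiplication by `a` in
the coordinates `(x, y)`. -/
structure LinearOnCap (F : Equiv.Perm S2) (e : ℤˣ) (a : ℂ) (δ : ℝ) : Prop where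
  pos : 0 < δ
  le_one : δ ≤ 1
  norm_mul_lt : ∀ w : ℂ, ‖w‖ < δ → ‖a * w‖ < 1
  map_hemi : ∀ w : ℂ, ‖w‖ < δ → F (hemi e w) = hemi e (a * w)

lemma exists_linearOnCap {F : Equiv.Perm S2} {e : ℤˣ} {a : ℂ} (hF : Continuous F)
    (hfix : F (pole e) = pole e) (h : ∀ᶠ p in 𝓝 (pole e), xy (F p) = a * xy p) :
    ∃ δ, LinearOnCap F e a δ := by
  have h0 : Tendsto (hemi e) (𝓝 0) (𝓝 (pole e)) := continuousAt_hemi e (by simp)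
  have h1 : ∀ᶠ p in 𝓝 (pole e), 0 < ((e : ℤ) : ℝ) * (F p).1 2 := by
    refine ((continuous_height e).comp hF).continuousAt.eventually_const_lt ?_
    simpa [hfix] using height_pole_pos e
  have h2 : ∀ᶠ w : ℂ in 𝓝 0, ‖a * w‖ < 1 :=
    (continuous_const.mul continuous_id).norm.continuousAt.eventually_lt_const (by simp)
  obtain ⟨δ, hδ, H⟩ := Metric.eventually_nhds_iff.1 ((h0.eventually (h.and h1)).and h2)
  refine ⟨min δ 1, lt_min hδ one_pos, min_le_right _ _, fun w hw => ?_, fun w hw => ?_⟩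
  · exact (H (by simpa using hw.trans_le (min_le_left _ _))).2
  · have hw1 := hw.trans_le (min_le_right _ _)
    obtain ⟨⟨e1, e2⟩, -⟩ := H (y := w) (by simpa using hw.trans_le (min_le_left _ _))
    rw [xy_hemi e hw1] at e1
    rw [← e1, hemi_xy e2]

lemma eventually_xy_inv {F : Equiv.Perm S2} {P : S2} {a : ℂ} (ha : a ≠ 0)
    (hF : Continuous F.symm) (hfix : F P = P) (h : ∀ᶠ p in 𝓝 P, xy (F p) = a * xy p) :
    ∀ᶠ p in 𝓝 P, xy (F⁻¹ p) = a⁻¹ * xy p := by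
  have ht : Tendsto F.symm (𝓝 P) (𝓝 P) := by
    have := hF.tendsto P
    rwa [(Equiv.symm_apply_eq F).2 hfix.symm] at this
  filter_upwards [ht.eventually h] with p hp
  rw [Equiv.apply_symm_apply] at hp
  rw [hp, inv_mul_cancel_left₀ ha]
  rfl

lemma LinearOnCap.pow_map {F : Equiv.Perm S2} {e : ℤˣ} {a : ℂ} {δ : ℝ} (h : LinearOnCap F e a δ)
    (ha : ‖a‖ ≤ 1) {w : ℂ} (hw : ‖w‖ < δ) (m : ℕ) :
    (F ^ m) (hemi e w) = hemi e (a ^ m * w) := by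
  induction m with
  | zero => simp
  | succ m ih =>
    rw [pow_succ', Equiv.Perm.mul_apply, ih, h.map_hemi, pow_succ', mul_assoc]
    rw [norm_mul, norm_pow]
    exact (mul_le_of_le_one_left (norm_nonneg _) (pow_le_one₀ (norm_nonneg _) ha)).trans_lt hw

/-! ## The derivative at a linearizable fixed point -/

/-- The derivative of the coordinates `(x, y)` at a pole, with its natural type. -/
def dxy (e : ℤˣ) : EuclideanSpace ℝ (Fin 2) →L[ℝ] ℂ := mfderiv (𝓡 2) 𝓘(ℝ, ℂ) xy (pole e)

/-- The derivative of `F` at a pole, as an endomorphism. -/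
def dpole (F : Equiv.Perm S2) (e : ℤˣ) : EuclideanSpace ℝ (Fin 2) →L[ℝ] EuclideanSpace ℝ (Fin 2) :=
  mfderiv (𝓡 2) (𝓡 2) F (pole e)

lemma dxy_surjective (e : ℤˣ) : Function.Surjective (dxy e) := by
  intro c
  have h0 : ‖(0 : ℂ)‖ < 1 := by simp
  have h1 := ((contMDiffAt_hemi e h0).mdifferentiableAt (by simp)).hasMFDerivAt
  have h2 := (contMDiff_xy.mdifferentiable (by simp) (hemi e 0)).hasMFDerivAt
  have h3 := h2.comp (0 : ℂ) h1
  have h4 : xy ∘ hemi e =ᶠ[𝓝 0] id := by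
    filter_upwards [Metric.ball_mem_nhds (0 : ℂ) one_pos] with w hw
    exact xy_hemi e (by simpa using hw)
  have h5 := hasMFDerivAt_unique (h3.congr_of_eventuallyEq h4.symm) (hasMFDerivAt_id (0 : ℂ))
  exact ⟨mfderiv 𝓘(ℝ, ℂ) (𝓡 2) (hemi e) 0 c, DFunLike.congr_fun h5 c⟩

lemma dxy_dpole {F : Equiv.Perm S2} {e : ℤˣ} {a : ℂ} (hF : ContMDiff (𝓡 2) (𝓡 2) 1 F)
    (hfix : F (pole e) = pole e) (h : ∀ᶠ p in 𝓝 (pole e), xy (F p) = a * xy p)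
    (v : EuclideanSpace ℝ (Fin 2)) : dxy e (dpole F e v) = a * dxy e v := by
  have h1 := (hF.mdifferentiable one_ne_zero (pole e)).hasMFDerivAt
  have h2 := (contMDiff_xy.mdifferentiable (by simp) (pole e)).hasMFDerivAt
  have h2' : HasMFDerivAt (𝓡 2) 𝓘(ℝ, ℂ) xy (F (pole e))
      (mfderiv (𝓡 2) 𝓘(ℝ, ℂ) xy (pole e)) := by rw [hfix]; exact h2
  have h3 := h2'.comp (pole e) h1
  have hm : HasMFDerivAt 𝓘(ℝ, ℂ) 𝓘(ℝ, ℂ) (fun w : ℂ => a * w) (xy (pole e))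
      (ContinuousLinearMap.mul ℝ ℂ a) :=
    (ContinuousLinearMap.mul ℝ ℂ a).hasFDerivAt.hasMFDerivAt
  have h4 := hm.comp (pole e) h2
  have h5 := hasMFDerivAt_unique (h3.congr_of_eventuallyEq (h.mono fun p hp => hp.symm)) h4
  exact DFunLike.congr_fun h5 v

lemma comp_aeval_apply {E : Type*} [AddCommGroup E] [Module ℝ E] (D : E →ₗ[ℝ] E)
    (L : E →ₗ[ℝ] ℂ) {a : ℂ} (h : ∀ v, L (D v) = a * L v) (P : Polynomial ℝ) (v : E) :
    L (Polynomial.aeval D P v) = Polynomial.aeval a P * L v := by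
  induction P using Polynomial.induction_on' generalizing v with
  | add P Q hP hQ => simp [hP, hQ, add_mul]
  | monomial k c =>
    have hk : ∀ k : ℕ, ∀ v, L ((D ^ k) v) = a ^ k * L v := by
      intro k
      induction k with
      | zero => simp
      | succ k ih => intro v; rw [pow_succ, Module.End.mul_apply, ih, h, pow_succ, mul_assoc]
    simp [Polynomial.aeval_monomial, hk, mul_assoc]

lemma mem_derivEigenvalues {F : Equiv.Perm S2} {e : ℤˣ} {a : ℂ}
    (hF : ContMDiff (𝓡 2) (𝓡 2) 1 F) (hfix : F (pole e) = pole e)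
    (h : ∀ᶠ p in 𝓝 (pole e), xy (F p) = a * xy p) : a ∈ derivEigenvalues F (pole e) := by
  obtain ⟨v, hv⟩ := dxy_surjective e 1
  have key := comp_aeval_apply (dpole F e).toLinearMap (dxy e).toLinearMap
    (dxy_dpole hF hfix h) (dpole F e).toLinearMap.charpoly v
  rw [LinearMap.aeval_self_charpoly] at key
  have hroot : Polynomial.aeval a (dpole F e).toLinearMap.charpoly = 0 := by
    simpa [hv] using key.symm
  exact hroot

lemma im_ne_zero_of_derivEigenvalues {F : Equiv.Perm S2} {e : ℤˣ} {a : ℂ}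
    (hF : ContMDiff (𝓡 2) (𝓡 2) 1 F) (hfix : F (pole e) = pole e)
    (h : ∀ᶠ p in 𝓝 (pole e), xy (F p) = a * xy p)
    (hμ : ∃ μ ∈ derivEigenvalues F (pole e), μ.im ≠ 0) : a.im ≠ 0 := by
  intro ha
  obtain ⟨μ, hμ, him⟩ := hμ
  have hinj : Function.Injective (dxy e).toLinearMap :=
    (LinearMap.injective_iff_surjective_of_finrank_eq_finrank (by simp)).2 (dxy_surjective e)
  have har : ((a.re : ℝ) : ℂ) = a := Complex.ext (by simp) (by simp [ha])
  have hD : (dpole F e).toLinearMap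
      = (1 : Module.End ℝ (EuclideanSpace ℝ (Fin 2))) - (1 - a.re) • 1 := by
    refine LinearMap.ext fun v => hinj ?_
    have h1 := dxy_dpole hF hfix h v
    rw [← har] at h1
    have h2 : ((1 : Module.End ℝ (EuclideanSpace ℝ (Fin 2))) - (1 - a.re) • 1) v = a.re • v := by
      rw [LinearMap.sub_apply, LinearMap.smul_apply, Module.End.one_apply]; module
    rw [h2]
    simpa using h1
  have hμ' : Polynomial.aeval μ (dpole F e).toLinearMap.charpoly = 0 := hμ
  rw [hD, LinearMap.charpoly_sub_smul, LinearMap.charpoly_one] at hμ'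
  simp at hμ'
  apply him
  rw [show μ = (a.re : ℂ) by linear_combination hμ']
  simp

/-! ## North-south dynamics -/

lemma LinearOnCap.map_pole {F : Equiv.Perm S2} {e : ℤˣ} {a : ℂ} {δ : ℝ}
    (h : LinearOnCap F e a δ) : F (pole e) = pole e := by
  simpa [pole] using h.map_hemi 0 (by simpa using h.pos)

lemma mem_nonwanderingSet_of_mapClusterPt {F : Equiv.Perm S2} {p x : S2}
    (h : MapClusterPt x atTop fun m : ℕ => (F ^ m) p) : x ∈ nonwanderingSet F := by
  intro U hU
  have hf := mapClusterPt_iff_frequently.1 h U hU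
  obtain ⟨i, hi⟩ := hf.exists
  obtain ⟨j, hj, hij⟩ := (hf.and_eventually (eventually_gt_atTop i)).exists
  refine ⟨j - i, by omega, (F ^ j) p, ⟨(F ^ i) p, hi, ?_⟩, hj⟩
  rw [← Equiv.Perm.mul_apply, ← pow_add, Nat.sub_add_cancel hij.le]

lemma LinearOnCap.tendsto_pole {F : Equiv.Perm S2} {e : ℤˣ} {a : ℂ} {δ : ℝ}
    (h : LinearOnCap F e a δ) (ha : ‖a‖ < 1) {p : S2} (hp : p ∈ cap e δ) :
    Tendsto (fun m : ℕ => (F ^ m) p) atTop (𝓝 (pole e)) := by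
  have h1 : Tendsto (fun m : ℕ => a ^ m * xy p) atTop (𝓝 0) := by
    simpa using (tendsto_pow_atTop_nhds_zero_of_norm_lt_one ha).mul_const (xy p)
  refine ((continuousAt_hemi e (w := 0) (by simp)).tendsto.comp h1).congr fun m => ?_
  rw [Function.comp_apply, ← h.pow_map ha.le hp.2, hemi_xy hp.1]

lemma tendsto_pole_neg {F : Equiv.Perm S2} {e : ℤˣ} {a b : ℂ} {δ δ' : ℝ}
    (h : LinearOnCap F e a δ) (ha : 1 < ‖a‖) (h' : LinearOnCap F (-e) b δ') (hb : ‖b‖ < 1)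
    (hΩ : nonwanderingSet F = {pole e, pole (-e)}) {p : S2} (hp : p ≠ pole e) :
    Tendsto (fun m : ℕ => (F ^ m) p) atTop (𝓝 (pole (-e))) := by
  by_cases hin : ∃ k : ℕ, (F ^ k) p ∈ cap (-e) δ'
  · obtain ⟨k, hk⟩ := hin
    rw [← tendsto_add_atTop_iff_nat k]
    simpa [pow_add] using h'.tendsto_pole hb hk
  exfalso
  push Not at hin
  have hlim : Tendsto (fun m : ℕ => (F ^ m) p) atTop (𝓝 (pole e)) := by
    refine tendsto_nhds_of_unique_mapClusterPt fun x hx => ?_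
    have hmem := mem_nonwanderingSet_of_mapClusterPt hx
    rw [hΩ] at hmem
    rcases hmem with hmem | hmem
    · exact hmem
    · rw [Set.mem_singleton_iff.1 hmem] at hx
      obtain ⟨k, hk⟩ := (hx.frequently (cap_mem_nhds (-e) h'.pos)).exists
      exact absurd hk (hin k)
  obtain ⟨k, hk⟩ := eventually_atTop.1 (hlim.eventually (cap_mem_nhds e h.pos))
  have hpow : ∀ m : ℕ, xy ((F ^ (k + m)) p) = a ^ m * xy ((F ^ k) p) := by
    intro m
    induction m with
    | zero => simp
    | succ m ih =>
      have hc : (F ^ (k + m)) p ∈ cap e δ := hk _ (by omega)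
      have hs : (F ^ (k + (m + 1))) p = hemi e (a * xy ((F ^ (k + m)) p)) := by
        rw [← h.map_hemi _ hc.2, hemi_xy hc.1, ← Equiv.Perm.mul_apply, ← pow_succ', add_assoc]
      rw [hs, xy_hemi e (h.norm_mul_lt _ hc.2), ih, pow_succ']
      ring
  have hzero : xy ((F ^ k) p) = 0 := by
    by_contra hne
    obtain ⟨m, hm⟩ := pow_unbounded_of_one_lt (δ / ‖xy ((F ^ k) p)‖) ha
    have h1 : ‖xy ((F ^ (k + m)) p)‖ < δ := (hk (k + m) (by omega)).2
    rw [hpow, norm_mul, norm_pow] at h1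
    rw [div_lt_iff₀ (norm_pos_iff.2 hne)] at hm
    exact hm.not_gt h1
  have hkp : (F ^ k) p = pole e := by
    rw [← hemi_xy (hk k le_rfl).1, hzero, pole]
  have hfix : (F ^ k) (pole e) = pole e := by
    rw [← Equiv.Perm.smul_def, ← MulAction.mem_stabilizer_iff]
    exact pow_mem (MulAction.mem_stabilizer_iff.2 h.map_pole) k
  exact hp ((F ^ k).injective (hkp.trans hfix.symm))

lemma nonwanderingSet_inv (F : Equiv.Perm S2) : nonwanderingSet F⁻¹ = nonwanderingSet F := by
  suffices H : ∀ F : Equiv.Perm S2, nonwanderingSet F ⊆ nonwanderingSet F⁻¹ from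
    (by simpa using H F⁻¹ : nonwanderingSet F⁻¹ ⊆ nonwanderingSet F).antisymm (H F)
  intro F p hp U hU
  obtain ⟨m, hm, -, ⟨q, hq, rfl⟩, hq'⟩ := hp U hU
  exact ⟨m, hm, q, ⟨(F ^ m) q, hq', by simp [inv_pow]⟩, hq⟩

/-! ## Global linearizing charts -/

/-- A diffeomorphism `K` from the plane onto the complement of the point `Q`, with inverse `H`,
which conjugates the multiplication by `a` to `F` and which is the inverse of the coordinates
`(x, y)` near the point `P`. -/
structure GlobalChart (F : Equiv.Perm S2) (P Q : S2) (a : ℂ) where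
  K : ℂ → S2
  H : S2 → ℂ
  smooth_K : ContMDiff 𝓘(ℝ, ℂ) (𝓡 2) ∞ K
  smooth_H : ∀ p, p ≠ Q → ContMDiffAt (𝓡 2) 𝓘(ℝ, ℂ) ∞ H p
  K_ne : ∀ w, K w ≠ Q
  H_K : ∀ w, H (K w) = w
  K_H : ∀ p, p ≠ Q → K (H p) = p
  K_zero : K 0 = P
  map_K : ∀ w, F (K w) = K (a * w)
  H_near : ∀ᶠ p in 𝓝 (P), H p = xy p

lemma contMDiff_perm_pow {F : Equiv.Perm S2} {r : ℕ∞} (hF : F ∈ diffGroup r) (m : ℕ) :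
    ContMDiff (𝓡 2) (𝓡 2) r ⇑(F ^ m) :=
  (pow_mem hF m).1

/-- The approximations `F^m ∘ hemi e ∘ a^{-m}` of the global chart. -/
def chartApprox (F : Equiv.Perm S2) (e : ℤˣ) (a : ℂ) (m : ℕ) (w : ℂ) : S2 :=
  (F ^ m) (hemi e (a⁻¹ ^ m * w))

section

variable {F : Equiv.Perm S2} {e : ℤˣ} {a : ℂ} {δ : ℝ}

lemma LinearOnCap.chartApprox_add (h : LinearOnCap F e a δ) (ha : 1 < ‖a‖) {m : ℕ} {w : ℂ}
    (hw : ‖a⁻¹ ^ m * w‖ < δ) (k : ℕ) :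
    ‖a⁻¹ ^ (m + k) * w‖ < δ ∧ chartApprox F e a (m + k) w = chartApprox F e a m w := by
  have ha0 : a ≠ 0 := norm_pos_iff.1 (one_pos.trans ha)
  induction k with
  | zero => exact ⟨hw, rfl⟩
  | succ k ih =>
    have h1 : a⁻¹ ^ (m + (k + 1)) * w = a⁻¹ * (a⁻¹ ^ (m + k) * w) := by
      rw [← add_assoc, pow_succ', mul_assoc]
    have h2 : ‖a⁻¹ ^ (m + (k + 1)) * w‖ < δ := by
      rw [h1, norm_mul, norm_inv]
      exact (mul_le_of_le_one_left (norm_nonneg _) (inv_le_one_of_one_le₀ ha.le)).trans_lt ih.1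
    refine ⟨h2, ?_⟩
    rw [← ih.2, chartApprox, ← add_assoc, pow_succ, Equiv.Perm.mul_apply]
    rw [add_assoc, h.map_hemi _ h2, h1, mul_inv_cancel_left₀ ha0, chartApprox]

lemma exists_norm_inv_pow_mul_lt (ha : 1 < ‖a‖) (hδ : 0 < δ) (w : ℂ) :
    ∃ m : ℕ, ‖a⁻¹ ^ m * w‖ < δ := by
  have h1 : Tendsto (fun m : ℕ => ‖a⁻¹ ^ m * w‖) atTop (𝓝 0) := by
    have h2 : ‖a⁻¹‖ < 1 := by rw [norm_inv]; exact inv_lt_one_of_one_lt₀ ha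
    simpa using ((tendsto_pow_atTop_nhds_zero_of_norm_lt_one h2).mul_const w).norm
  exact (h1.eventually_lt_const hδ).exists

lemma LinearOnCap.nonempty_globalChart (h : LinearOnCap F e a δ) (ha : 1 < ‖a‖)
    (hF : F ∈ diffGroup ⊤) (hfix : F (pole (-e)) = pole (-e))
    (hlim : ∀ p, p ≠ pole (-e) → Tendsto (fun m : ℕ => (F⁻¹ ^ m) p) atTop (𝓝 (pole e))) :
    Nonempty (GlobalChart F (pole e) (pole (-e)) a) := by
  have ha0 : a ≠ 0 := norm_pos_iff.1 (one_pos.trans ha)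
  have hpow : ∀ m : ℕ, a ^ m ≠ 0 := fun m => pow_ne_zero m ha0
  choose m₀ hm₀ using exists_norm_inv_pow_mul_lt ha h.pos
  let K : ℂ → S2 := fun w => chartApprox F e a (m₀ w) w
  have hK : ∀ m w, ‖a⁻¹ ^ m * w‖ < δ → K w = chartApprox F e a m w := by
    intro m w hw
    rw [← (h.chartApprox_add ha hw (m₀ w)).2, add_comm, (h.chartApprox_add ha (hm₀ w) m).2]
  have hinj : Function.Injective K := by
    intro w w' hww
    have h1 := h.chartApprox_add ha (hm₀ w) (m₀ w')
    have h2 := h.chartApprox_add ha (hm₀ w') (m₀ w)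
    rw [add_comm] at h2
    have h3 : chartApprox F e a (m₀ w + m₀ w') w = chartApprox F e a (m₀ w + m₀ w') w' := by
      rw [h1.2, h2.2]; exact hww
    have h4 := congrArg xy ((F ^ (m₀ w + m₀ w')).injective h3)
    rw [xy_hemi e (h1.1.trans_le h.le_one), xy_hemi e (h2.1.trans_le h.le_one)] at h4
    exact mul_left_cancel₀ (pow_ne_zero _ (inv_ne_zero ha0)) h4
  have hK_cap : ∀ m p, (F⁻¹ ^ m) p ∈ cap e δ → K (a ^ m * xy ((F⁻¹ ^ m) p)) = p := by
    intro m p hp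
    have h1 : a⁻¹ ^ m * (a ^ m * xy ((F⁻¹ ^ m) p)) = xy ((F⁻¹ ^ m) p) := by
      rw [inv_pow, inv_mul_cancel_left₀ (hpow m)]
    rw [hK m _ (by rw [h1]; exact hp.2), chartApprox, h1, hemi_xy hp.1]
    simp [inv_pow]
  have hH_K : ∀ w, Function.invFun K (K w) = w := Function.leftInverse_invFun hinj
  have hH_cap : ∀ m p, (F⁻¹ ^ m) p ∈ cap e δ →
      Function.invFun K p = a ^ m * xy ((F⁻¹ ^ m) p) := by
    intro m p hp
    conv_lhs => rw [← hK_cap m p hp]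
    exact hH_K _
  have hcap : ∀ p, p ≠ pole (-e) → ∃ m : ℕ, (F⁻¹ ^ m) p ∈ cap e δ := fun p hp =>
    ((hlim p hp).eventually (cap_mem_nhds e h.pos)).exists
  refine ⟨⟨K, Function.invFun K, ?_, ?_, ?_, hH_K, ?_, ?_, ?_, ?_⟩⟩
  · intro w
    have hw := hm₀ w
    have h1 : ∀ᶠ z in 𝓝 w, ‖a⁻¹ ^ (m₀ w) * z‖ < δ :=
      (continuous_const.mul continuous_id).norm.continuousAt.eventually_lt_const hw
    have h2 : K =ᶠ[𝓝 w] chartApprox F e a (m₀ w) := h1.mono fun z hz => hK _ z hz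
    refine ContMDiffAt.congr_of_eventuallyEq ?_ h2
    refine ContMDiffAt.comp w (contMDiff_perm_pow hF _).contMDiffAt ?_
    refine ContMDiffAt.comp (g := hemi e) w (contMDiffAt_hemi e (hw.trans_le h.le_one)) ?_
    exact (contDiff_const.mul contDiff_id).contMDiff.contMDiffAt
  · intro p hp
    obtain ⟨m, hm⟩ := hcap p hp
    have hsm := contMDiff_perm_pow (inv_mem hF) m
    have h1 : ∀ᶠ q in 𝓝 p, (F⁻¹ ^ m) q ∈ cap e δ :=
      hsm.continuous.continuousAt.eventually_mem ((isOpen_cap e δ).mem_nhds hm)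
    refine ContMDiffAt.congr_of_eventuallyEq ?_ (h1.mono fun q hq => hH_cap m q hq)
    have h2 : ContMDiff 𝓘(ℝ, ℂ) 𝓘(ℝ, ℂ) ∞ fun z : ℂ => a ^ m * z :=
      (contDiff_const.mul contDiff_id).contMDiff
    exact (h2.comp (contMDiff_xy.comp hsm)).contMDiffAt
  · intro w hw
    have hfix' : (F ^ m₀ w) (pole (-e)) = pole (-e) := by
      rw [← Equiv.Perm.smul_def, ← MulAction.mem_stabilizer_iff]
      exact pow_mem (MulAction.mem_stabilizer_iff.2 hfix) _
    have h1 : hemi e (a⁻¹ ^ m₀ w * w) = pole (-e) :=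
      (F ^ m₀ w).injective (Eq.trans hw hfix'.symm)
    have h2 := height_hemi_pos e ((hm₀ w).trans_le h.le_one)
    rw [h1] at h2
    exact (height_pole_neg e).not_gt h2
  · intro p hp
    obtain ⟨m, hm⟩ := hcap p hp
    rw [hH_cap m p hm, hK_cap m p hm]
  · rw [hK 0 0 (by simpa using h.pos)]
    simp [chartApprox, pole]
  · intro w
    have h1 := h.chartApprox_add ha (hm₀ w) 1
    have h2 : a⁻¹ ^ (m₀ w + 1) * (a * w) = a⁻¹ ^ m₀ w * w := by
      rw [pow_succ, mul_assoc, inv_mul_cancel_left₀ ha0]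
    rw [hK (m₀ w + 1) (a * w) (by rw [h2]; exact hm₀ w), chartApprox, h2, pow_succ',
      Equiv.Perm.mul_apply]
    rfl
  · filter_upwards [cap_mem_nhds e h.pos] with p hp
    simpa using hH_cap 0 p hp

end


namespace GlobalChart

variable {F : Equiv.Perm S2} {P Q : S2} {a : ℂ}

lemma K_injective (G : GlobalChart F P Q a) : Function.Injective G.K :=
  Function.LeftInverse.injective G.H_K

lemma H_base (G : GlobalChart F P Q a) : G.H P = 0 :=
  (congrArg G.H G.K_zero).symm.trans (G.H_K 0)

lemma base_ne (G : GlobalChart F P Q a) : P ≠ Q := G.K_zero ▸ G.K_ne 0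

lemma H_ne_zero (G : GlobalChart F P Q a) {p : S2} (hP : p ≠ P) (hQ : p ≠ Q) : G.H p ≠ 0 :=
  fun h => hP (by rw [← G.K_H p hQ, h, G.K_zero])

lemma K_ne_base (G : GlobalChart F P Q a) {w : ℂ} (hw : w ≠ 0) : G.K w ≠ P := fun h =>
  hw (by rw [← G.H_K w, h, G.H_base])

lemma map_ne (G : GlobalChart F P Q a) {p : S2} (hp : p ≠ Q) : F p ≠ Q := by
  rw [← G.K_H p hp, G.map_K]
  exact G.K_ne _

lemma H_map (G : GlobalChart F P Q a) {p : S2} (hp : p ≠ Q) : G.H (F p) = a * G.H p := by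
  conv_lhs => rw [← G.K_H p hp, G.map_K, G.H_K]

lemma inv_K (G : GlobalChart F P Q a) (ha : a ≠ 0) (w : ℂ) : F⁻¹ (G.K w) = G.K (a⁻¹ * w) := by
  rw [Equiv.Perm.inv_eq_iff_eq, G.map_K, mul_inv_cancel_left₀ ha]

lemma map_far (G : GlobalChart F P Q a) (ha : a ≠ 0) : F Q = Q := by
  by_contra h
  have h1 := G.inv_K ha (G.H (F Q))
  rw [G.K_H _ h, show F⁻¹ (F Q) = Q from F.symm_apply_apply Q] at h1
  exact G.K_ne _ h1.symm

lemma zpow_K (G : GlobalChart F P Q a) (ha : a ≠ 0) (k : ℤ) (w : ℂ) :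
    (F ^ k) (G.K w) = G.K (a ^ k * w) := by
  induction k generalizing w with
  | zero => simp
  | succ k ih => rw [zpow_add_one, Equiv.Perm.mul_apply, G.map_K, ih, zpow_add_one₀ ha, mul_assoc]
  | pred k ih =>
    rw [zpow_sub_one, Equiv.Perm.mul_apply, G.inv_K ha, ih, zpow_sub_one₀ ha, mul_assoc]

lemma tendsto_inv_pow (G : GlobalChart F P Q a) (ha : 1 < ‖a‖) {p : S2} (hp : p ≠ Q) :
    Tendsto (fun m : ℕ => (F⁻¹ ^ m) p) atTop (𝓝 P) := by
  have ha0 : a ≠ 0 := norm_pos_iff.1 (one_pos.trans ha)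
  have h2 : ‖a⁻¹‖ < 1 := by rw [norm_inv]; exact inv_lt_one_of_one_lt₀ ha
  have h3 : Tendsto (fun m : ℕ => a⁻¹ ^ m * G.H p) atTop (𝓝 0) := by
    simpa using (tendsto_pow_atTop_nhds_zero_of_norm_lt_one h2).mul_const (G.H p)
  have h4 := (G.smooth_K.continuous.tendsto 0).comp h3
  rw [G.K_zero] at h4
  refine h4.congr fun m => ?_
  have h5 := G.zpow_K ha0 (-(m : ℤ)) (G.H p)
  rw [G.K_H p hp] at h5
  simpa [inv_pow] using h5.symm

/-- In the chart, the identification of the orbit torus with `T_C` is the projection. -/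
lemma endMap_mk (G : GlobalChart F P Q a) (ha : 1 < ‖a‖) {f : Equiv.Perm S2}
    (hf : f = F ∨ f = F⁻¹) {C : Conformal} (hC : a = C.mult ∨ a = C.mult⁻¹)
    (hPQ : ∀ p : S2, p ≠ north ∧ p ≠ south → p ≠ Q)
    (p : {p : S2 // p ≠ north ∧ p ≠ south}) (u : ℂˣ) (hu : (u : ℂ) = G.H p.1) :
    endMap f F⁻¹ C (Quotient.mk (orbitSetoid f) p) = QuotientGroup.mk u := by
  have ha0 : a ≠ 0 := norm_pos_iff.1 (one_pos.trans ha)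
  let U : ℂˣ := Units.mk0 a ha0
  have hU : U ∈ Subgroup.zpowers C.unit := by
    rcases hC with h | h
    · have : U = C.unit := Units.ext h
      rw [this]; exact Subgroup.mem_zpowers _
    · have : U = C.unit⁻¹ := Units.ext (by simpa [U, Conformal.unit] using h)
      rw [this]; exact inv_mem (Subgroup.mem_zpowers _)
  have hmk : ∀ k : ℤ, (QuotientGroup.mk (U ^ k * u) : C.Torus) = QuotientGroup.mk u := by
    intro k
    rw [QuotientGroup.eq, mul_inv_rev, mul_comm u⁻¹, inv_mul_cancel_right]
    exact inv_mem (zpow_mem hU k)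
  have hev : ∀ p' : {p : S2 // p ≠ north ∧ p ≠ south},
      Quotient.mk (orbitSetoid f) p' = Quotient.mk (orbitSetoid f) p →
      ∀ᶠ m : ℕ in atTop, ∃ w : ℂˣ, (w : ℂ) = xy ((F⁻¹ ^ m) p'.1) ∧
        (QuotientGroup.mk w : C.Torus) = QuotientGroup.mk u := by
    intro p' hp'
    obtain ⟨k, hk⟩ : ∃ k : ℤ, p'.1 = (F ^ k) p.1 := by
      obtain ⟨k, hk⟩ : Equiv.Perm.SameCycle f p'.1 p.1 := Quotient.exact hp'
      rcases hf with rfl | rfl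
      · exact ⟨-k, by rw [← hk]; simp⟩
      · exact ⟨k, by rw [← hk]; simp⟩
    filter_upwards [(G.tendsto_inv_pow ha (hPQ _ p'.2)).eventually G.H_near] with m hm
    refine ⟨U ^ (-(m : ℤ) + k) * u, ?_, hmk _⟩
    have h1 : (F⁻¹ ^ m) p'.1 = G.K (a ^ (-(m : ℤ) + k) * G.H p.1) := by
      rw [← G.zpow_K ha0, G.K_H _ (hPQ _ p.2), zpow_add, Equiv.Perm.mul_apply, ← hk]
      simp [inv_pow]
    rw [← hm, h1, G.H_K]
    simp [U, hu]
  have hspec := Classical.epsilon_spec (p := fun c : C.Torus =>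
    ∀ p' : {p : S2 // p ≠ north ∧ p ≠ south},
    Quotient.mk (orbitSetoid f) p' = Quotient.mk (orbitSetoid f) p →
      ∀ᶠ m : ℕ in atTop, ∃ w : ℂˣ, (w : ℂ) = xy ((F⁻¹ ^ m) p'.1) ∧
        (QuotientGroup.mk w : C.Torus) = c) ⟨_, hev⟩
  obtain ⟨m, ⟨w, hw, hwu⟩, w', hw', hwe⟩ := ((hev p rfl).and (hspec p rfl)).exists
  have : w = w' := Units.ext (hw.trans hw'.symm)
  subst this
  exact hwe.symm.trans hwu

end GlobalChart

/-! ## The Mather invariant in the global charts -/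

section

variable {f : Equiv.Perm S2} {A B : Conformal}

lemma torusMap_chart (G : GlobalChart f north south A.mult)
    (G' : GlobalChart f⁻¹ south north B.mult⁻¹) (hA : 1 < ‖A.mult‖) (hB : 1 < ‖B.mult⁻¹‖) (n : ℤ)
    {u v : ℂˣ} (hv : (v : ℂ) = G'.H (G.K u)) :
    torusMap f A B n (chartLift A 0 u) = chartLift B n v := by
  have hM : ∀ u : ℂˣ, G.K u ≠ north ∧ G.K u ≠ south := fun u => ⟨G.K_ne_base u.ne_zero, G.K_ne _⟩
  have hN : ∀ (p : {p : S2 // p ≠ north ∧ p ≠ south}) (u : ℂˣ), (u : ℂ) = G.H p.1 →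
      piNorth f A (Quotient.mk _ p) = QuotientGroup.mk u := fun p u hu =>
    G.endMap_mk hA (Or.inl rfl) (Or.inl rfl) (fun p hp => hp.2) p u hu
  have hS : ∀ (p : {p : S2 // p ≠ north ∧ p ≠ south}) (u : ℂˣ), (u : ℂ) = G'.H p.1 →
      piSouth f B (Quotient.mk _ p) = QuotientGroup.mk u := fun p u hu => by
    have := G'.endMap_mk hB (f := f) (Or.inr (inv_inv f).symm) (Or.inr rfl)
      (fun p hp => hp.1) p u hu
    rwa [inv_inv] at this
  have hinv : Function.invFun (piNorth f A) (QuotientGroup.mk u)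
      = Quotient.mk (orbitSetoid f) ⟨G.K u, hM u⟩ := by
    have hex : ∃ q, piNorth f A q = QuotientGroup.mk u :=
      ⟨Quotient.mk _ ⟨G.K u, hM u⟩, hN _ u (G.H_K u).symm⟩
    have heq := Function.invFun_eq hex
    obtain ⟨p, hp⟩ := Quotient.exists_rep (Function.invFun (piNorth f A) (QuotientGroup.mk u))
    rw [← hp] at heq ⊢
    rw [hN p (Units.mk0 _ (G.H_ne_zero p.2.1 p.2.2)) rfl, QuotientGroup.eq] at heq
    obtain ⟨k, hk⟩ := heq
    have hk' : (u : ℂ) = A.mult ^ k * G.H p.1 := by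
      have := congrArg Units.val (eq_inv_mul_iff_mul_eq.1 hk)
      simpa [Conformal.unit, mul_comm] using this.symm
    refine Quotient.sound ⟨k, ?_⟩
    change (f ^ k) p.1 = G.K u
    rw [hk', ← G.zpow_K A.mult_ne_zero, G.K_H _ p.2.2]
  have hchart : (chart A 0).symm (chartLift A 0 u) = QuotientGroup.mk u :=
    (Equiv.symm_apply_eq _).2 rfl
  simp only [torusMap, Function.comp_apply, hchart, hinv]
  rw [hS _ v hv]
  rfl

lemma coe_eq_coe_add {x y z : ℝ} (h : (x : AddCircle (1 : ℝ)) = (y : AddCircle (1 : ℝ)) + z) :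
    ∃ k : ℤ, x = y + z + k := by
  rw [← AddCircle.coe_add, ← sub_eq_zero, ← AddCircle.coe_sub, AddCircle.coe_eq_zero_iff] at h
  obtain ⟨k, hk⟩ := h
  exact ⟨k, by simp at hk; linarith⟩

lemma chartLift_flowUnit_one (A : Conformal) (n : ℤ) (s t : ℝ) :
    chartLift A n (flowUnit A n s t) = ((s : AddCircle (1 : ℝ)), (t : AddCircle (1 : ℝ))) := by
  have h := chartLift_flow A n s t 1
  rw [mul_one] at h
  rw [h]
  simp [chartLift]

lemma continuous_flowUnit (A : Conformal) (n : ℤ) :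
    Continuous fun q : ℝ × ℝ => (flowUnit A n q.1 q.2 : ℂ) := by
  simp only [flowUnit, Units.val_mk0]
  fun_prop

/-- If the Mather invariant is a translation, the transition between the two global charts carries
the flows of `Z` and `X_{A,0}` to the flows of `Z` and `X_{B,n}`. -/
lemma exists_transition (G : GlobalChart f north south A.mult)
    (G' : GlobalChart f⁻¹ south north B.mult⁻¹) (hA : 1 < ‖A.mult‖) (hB : 1 < ‖B.mult⁻¹‖) {n : ℤ}
    (htrans : IsTranslation (matherInvariant f A B n)) :
    ∃ κ : ℂˣ, ∀ s t : ℝ, G.K (flowUnit A 0 s t) = G'.K (κ * flowUnit B n s t) := by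
  obtain ⟨⟨c₁, c₂⟩, hc⟩ := htrans
  obtain ⟨c₁, rfl⟩ := QuotientAddGroup.mk_surjective c₁
  obtain ⟨c₂, rfl⟩ := QuotientAddGroup.mk_surjective c₂
  let Θ : ℝ × ℝ → ℂ := fun q => G'.H (G.K (flowUnit A 0 q.1 q.2))
  have hΘ0 : ∀ q, Θ q ≠ 0 := fun q =>
    G'.H_ne_zero (G.K_ne _) (G.K_ne_base (Units.ne_zero _))
  have hΘc : Continuous Θ := by
    rw [continuous_iff_continuousAt]
    intro q
    refine ContinuousAt.comp (g := G'.H) (f := fun q : ℝ × ℝ => G.K (flowUnit A 0 q.1 q.2)) ?_ ?_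
    · exact (G'.smooth_H _ (G.K_ne_base (Units.ne_zero _))).continuousAt
    · exact (G.smooth_K.continuous.comp (continuous_flowUnit A 0)).continuousAt
  let τ : ℝ × ℝ → ℝ := fun q => Real.log ‖Θ q‖ / Real.log B.ratio
  have hτc : Continuous τ :=
    (hΘc.norm.log fun q => norm_ne_zero_iff.2 (hΘ0 q)).div_const _
  have key : ∀ q : ℝ × ℝ, ∃ l k : ℤ, τ q = q.2 + c₂ + k ∧
      Units.mk0 (Θ q) (hΘ0 q) = flowUnit B n (q.1 + c₁ + l) (q.2 + c₂ + k) := by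
    intro q
    let v := Units.mk0 (Θ q) (hΘ0 q)
    have h1 := torusMap_chart G G' hA hB n (u := flowUnit A 0 q.1 q.2) (v := v) rfl
    have h2 := hc (chartLift A 0 (flowUnit A 0 q.1 q.2))
    rw [matherInvariant, h1, chartLift_flowUnit_one] at h2
    obtain ⟨h3, h4⟩ := Prod.ext_iff.1 h2
    obtain ⟨l, hl⟩ := coe_eq_coe_add h3
    obtain ⟨k, hk⟩ := coe_eq_coe_add h4
    refine ⟨l, k, hk, ?_⟩
    rw [← hl, ← hk]
    exact eq_flowUnit B n v
  choose l k hk hv using key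
  have hkc : Continuous k := by
    rw [Int.isClosedEmbedding_coe_real.isEmbedding.continuous_iff]
    have : (Int.cast ∘ k : ℝ × ℝ → ℝ) = fun q => τ q - q.2 - c₂ := by
      funext q
      simp only [Function.comp_apply, hk q]
      ring
    rw [this]
    fun_prop
  refine ⟨flowUnit B n c₁ (c₂ + k 0), fun s t => ?_⟩
  have h1 : k (s, t) = k 0 := PreconnectedSpace.constant inferInstance hkc
  have h2 := congrArg Units.val (hv (s, t))
  have h3 : flowUnit B n (s + c₁ + l (s, t)) (t + c₂ + k (s, t))
      = flowUnit B n c₁ (c₂ + k 0) * flowUnit B n s t := by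
    have h4 : flowUnit B n (l (s, t) : ℤ) ((0 : ℤ) : ℝ) = 1 := by rw [flowUnit_int, zpow_zero]
    rw [h1, ← flowUnit_mul, ← mul_one (flowUnit B n (c₁ + s) _), ← h4, ← flowUnit_mul]
    congr 1
    · ring
    · push_cast; ring
  rw [← Units.val_mul, ← h3, ← h2]
  exact (G'.K_H _ (G.K_ne_base (Units.ne_zero _))).symm

end

/-! ## The action of `ℂˣ` by scalings in a global chart -/

namespace GlobalChart

variable {F : Equiv.Perm S2} {P Q : S2} {a : ℂ}

open Classical in
/-- The multiplication by `c` in the chart, extended by fixing the remaining point. -/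
def scaleFun (G : GlobalChart F P Q a) (c : ℂˣ) (p : S2) : S2 :=
  if p = Q then Q else G.K (c * G.H p)

lemma scaleFun_K (G : GlobalChart F P Q a) (c : ℂˣ) (w : ℂ) :
    G.scaleFun c (G.K w) = G.K (c * w) := by
  rw [scaleFun, if_neg (G.K_ne w), G.H_K]

lemma scaleFun_far (G : GlobalChart F P Q a) (c : ℂˣ) : G.scaleFun c Q = Q := if_pos rfl

/-- The action of `ℂˣ` on the sphere which in the chart is the multiplication of numbers. -/
def scaling (G : GlobalChart F P Q a) : ℂˣ →* Equiv.Perm S2 :=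
  MonoidHom.toHomPerm
    { toFun := G.scaleFun
      map_one' := by
        funext p
        change G.scaleFun 1 p = p
        by_cases h : p = Q
        · rw [h, G.scaleFun_far]
        · rw [← G.K_H p h, G.scaleFun_K, Units.val_one, one_mul]
      map_mul' := fun c d => by
        funext p
        change G.scaleFun (c * d) p = G.scaleFun c (G.scaleFun d p)
        by_cases h : p = Q
        · rw [h, G.scaleFun_far, G.scaleFun_far, G.scaleFun_far]
        · rw [← G.K_H p h, G.scaleFun_K, G.scaleFun_K, G.scaleFun_K, Units.val_mul, mul_assoc] }

lemma scaling_K (G : GlobalChart F P Q a) (c : ℂˣ) (w : ℂ) :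
    G.scaling c (G.K w) = G.K (c * w) := G.scaleFun_K c w

lemma scaling_far (G : GlobalChart F P Q a) (c : ℂˣ) : G.scaling c Q = Q := G.scaleFun_far c

lemma scaling_eq (G : GlobalChart F P Q a) (c : ℂˣ) {p : S2} (hp : p ≠ Q) :
    G.scaling c p = G.K (c * G.H p) := by
  rw [← G.scaling_K, G.K_H p hp]

lemma scaling_injective (G : GlobalChart F P Q a) : Function.Injective G.scaling := by
  intro c d h
  have h1 := DFunLike.congr_fun h (G.K 1)
  rw [G.scaling_K, G.scaling_K] at h1
  exact Units.ext (by simpa using G.K_injective h1)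

lemma scaling_commute (G : GlobalChart F P Q a) (ha : a ≠ 0) (c : ℂˣ) :
    G.scaling c * F = F * G.scaling c := by
  ext1 p
  by_cases hp : p = Q
  · subst hp
    rw [Equiv.Perm.mul_apply, Equiv.Perm.mul_apply, G.scaling_far, G.map_far ha, G.scaling_far]
  · rw [← G.K_H p hp, Equiv.Perm.mul_apply, Equiv.Perm.mul_apply, G.scaling_K, G.map_K, G.map_K,
      G.scaling_K, mul_left_comm]

lemma contMDiffAt_conj_mul (G : GlobalChart F P Q a) (c : ℂ) {p : S2} (hp : p ≠ Q) :
    ContMDiffAt (𝓡 2) (𝓡 2) ∞ (fun p => G.K (c * G.H p)) p := by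
  have h2 : ContMDiff 𝓘(ℝ, ℂ) 𝓘(ℝ, ℂ) ∞ fun z : ℂ => c * z :=
    (contDiff_const.mul contDiff_id).contMDiff
  exact (G.smooth_K.comp h2).contMDiffAt.comp p (G.smooth_H p hp)

/-! ## Diffeomorphisms commuting with `F` -/

lemma eq_of_map_eq (G : GlobalChart F P Q a) (ha : 1 < ‖a‖) {p : S2} (hp : F p = p) (hQ : p ≠ Q) :
    p = P := by
  by_contra hP
  have h1 := G.H_map hQ
  rw [hp] at h1
  have h2 : a = 1 := mul_right_cancel₀ (G.H_ne_zero hP hQ) (h1.symm.trans (one_mul _).symm)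
  rw [h2, norm_one] at ha
  exact lt_irrefl _ ha

lemma map_base_of_commute (G : GlobalChart F P Q a) (ha : 1 < ‖a‖) {g : Equiv.Perm S2}
    (hg : Continuous g) (hc : g * F = F * g) : g P = P := by
  have hFP : F P = P := by
    have := G.map_K 0
    rwa [mul_zero, G.K_zero] at this
  have hfix : F (g P) = g P := by
    rw [← Equiv.Perm.mul_apply, ← hc, Equiv.Perm.mul_apply, hFP]
  refine G.eq_of_map_eq ha hfix fun hQ => ?_
  have hp : G.K 1 ≠ P := G.K_ne_base one_ne_zero
  have h1 := (hg.tendsto P).comp (G.tendsto_inv_pow ha (G.K_ne 1))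
  have hgp : g (G.K 1) ≠ Q := fun h => hp (g.injective (h.trans hQ.symm))
  have h2 := G.tendsto_inv_pow ha hgp
  have hcomm : ∀ m : ℕ, g ((F⁻¹ ^ m) (G.K 1)) = (F⁻¹ ^ m) (g (G.K 1)) := fun m =>
    DFunLike.congr_fun (((show Commute g F from hc).inv_right).pow_right m) (G.K 1)
  have h3 := tendsto_nhds_unique h1 (h2.congr fun m => (hcomm m).symm)
  exact G.base_ne (h3.symm.trans hQ)

lemma map_far_of_commute (G : GlobalChart F P Q a) (ha : 1 < ‖a‖) {g : Equiv.Perm S2}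
    (hg : Continuous g) (hc : g * F = F * g) : g Q = Q := by
  have ha0 : a ≠ 0 := norm_pos_iff.1 (one_pos.trans ha)
  by_contra h
  have hfix : F (g Q) = g Q := by
    rw [← Equiv.Perm.mul_apply, ← hc, Equiv.Perm.mul_apply, G.map_far ha0]
  have h1 := G.eq_of_map_eq ha hfix h
  exact G.base_ne (g.injective ((G.map_base_of_commute ha hg hc).trans h1.symm))

end GlobalChart

lemma real_linear_eq_mul {L : ℂ →L[ℝ] ℂ} {a : ℂ} (him : a.im ≠ 0)
    (h : ∀ w, L (a * w) = a * L w) (w : ℂ) : L w = L 1 * w := by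
  have hre : ∀ z : ℂ, L z = z.re * L 1 + z.im * L Complex.I := by
    intro z
    have hz : z = z.re • (1 : ℂ) + z.im • Complex.I := by simp
    conv_lhs => rw [hz]
    rw [map_add, map_smul, map_smul]
    simp
  have h1 := h 1
  rw [mul_one, hre a] at h1
  have hI : L Complex.I = Complex.I * L 1 := by
    have h2 : (a.im : ℂ) ≠ 0 := by exact_mod_cast him
    apply mul_left_cancel₀ h2
    linear_combination h1 - L 1 * (Complex.re_add_im a)
  rw [hre w, hI]
  linear_combination L 1 * (Complex.re_add_im w)

/-- A map of the plane differentiable at the origin and commuting with an expanding conformal map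
which is not real is the multiplication by a complex number. -/
lemma exists_eq_mul_of_commute {φ : ℂ → ℂ} {a : ℂ} (ha : 1 < ‖a‖) (him : a.im ≠ 0)
    (hφ : DifferentiableAt ℝ φ 0) (h0 : φ 0 = 0) (hc : ∀ w, φ (a * w) = a * φ w) :
    ∃ c : ℂ, ∀ w, φ w = c * w := by
  have ha0 : a ≠ 0 := norm_pos_iff.1 (one_pos.trans ha)
  have hd := hφ.hasFDerivAt
  set L := fderiv ℝ φ 0
  have hL : ∀ w, L (a * w) = a * L w := by
    have hm : ∀ z : ℂ, HasFDerivAt (fun w : ℂ => a * w) (ContinuousLinearMap.mul ℝ ℂ a) z :=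
      fun z => (ContinuousLinearMap.mul ℝ ℂ a).hasFDerivAt
    have hd' : HasFDerivAt φ L (a * 0) := by rwa [mul_zero]
    have h1 := HasFDerivAt.comp (0 : ℂ) hd' (hm 0)
    have h2 := (hm (φ 0)).comp (0 : ℂ) hd
    have h3 : φ ∘ (fun w => a * w) = (fun w => a * w) ∘ φ := funext hc
    rw [h3] at h1
    exact fun w => DFunLike.congr_fun (h1.unique h2) w
  refine ⟨L 1, fun w => ?_⟩
  rw [← real_linear_eq_mul him hL w, ← sub_eq_zero, ← norm_le_zero_iff]
  have hlo := (hasFDerivAt_iff_isLittleO_nhds_zero.1 hd)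
  simp only [zero_add, h0, sub_zero] at hlo
  have hpow : ∀ m : ℕ, φ (a⁻¹ ^ m * w) - L (a⁻¹ ^ m * w) = a⁻¹ ^ m * (φ w - L w) := by
    intro m
    induction m with
    | zero => simp
    | succ m ih =>
      have e1 : a * (a⁻¹ ^ (m + 1) * w) = a⁻¹ ^ m * w := by
        rw [pow_succ', ← mul_assoc, mul_inv_cancel_left₀ ha0]
      have e2 := hc (a⁻¹ ^ (m + 1) * w)
      have e3 := hL (a⁻¹ ^ (m + 1) * w)
      rw [e1] at e2 e3
      rw [e2, e3] at ih
      apply mul_left_cancel₀ ha0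
      rw [mul_sub, ih, pow_succ', mul_assoc, mul_inv_cancel_left₀ ha0]
  have hlim : Tendsto (fun m : ℕ => a⁻¹ ^ m * w) atTop (𝓝 0) := by
    have h2 : ‖a⁻¹‖ < 1 := by rw [norm_inv]; exact inv_lt_one_of_one_lt₀ ha
    simpa using (tendsto_pow_atTop_nhds_zero_of_norm_lt_one h2).mul_const w
  have hbound : ∀ ε : ℝ, 0 < ε → ‖φ w - L w‖ ≤ ε * ‖w‖ := by
    intro ε hε
    obtain ⟨m, hm⟩ := (hlim.eventually (hlo.def hε)).exists
    rw [hpow, norm_mul, norm_mul, mul_left_comm] at hm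
    exact le_of_mul_le_mul_left hm (norm_pos_iff.2 (pow_ne_zero m (inv_ne_zero ha0)))
  have hz : Tendsto (fun ε : ℝ => ε * ‖w‖) (𝓝[>] 0) (𝓝 0) := by
    have : Tendsto (fun ε : ℝ => ε * ‖w‖) (𝓝 0) (𝓝 (0 * ‖w‖)) := tendsto_id.mul_const _
    rw [zero_mul] at this
    exact this.mono_left nhdsWithin_le_nhds
  exact ge_of_tendsto hz (eventually_mem_nhdsWithin.mono fun ε hε => hbound ε hε)

namespace GlobalChart

variable {F : Equiv.Perm S2} {P Q : S2} {a : ℂ}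

lemma exists_scaling_eq (G : GlobalChart F P Q a) (ha : 1 < ‖a‖) (him : a.im ≠ 0)
    {g : Equiv.Perm S2} (hg : ContMDiff (𝓡 2) (𝓡 2) 1 g) (hc : g * F = F * g) :
    ∃ c : ℂˣ, G.scaling c = g := by
  have hP := G.map_base_of_commute ha hg.continuous hc
  have hQ := G.map_far_of_commute ha hg.continuous hc
  have hne : ∀ w, g (G.K w) ≠ Q := fun w h => G.K_ne w (g.injective (h.trans hQ.symm))
  let φ : ℂ → ℂ := fun w => G.H (g (G.K w))
  have hφ : DifferentiableAt ℝ φ 0 := by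
    rw [← mdifferentiableAt_iff_differentiableAt]
    have h1 : MDifferentiableAt 𝓘(ℝ, ℂ) (𝓡 2) (fun w => g (G.K w)) 0 :=
      (hg.mdifferentiable one_ne_zero _).comp (0 : ℂ) (G.smooth_K.mdifferentiable (by simp) 0)
    exact ((G.smooth_H _ (hne 0)).mdifferentiableAt (by simp)).comp (0 : ℂ) h1
  have hφ0 : φ 0 = 0 := by
    change G.H (g (G.K 0)) = 0
    rw [G.K_zero, hP, G.H_base]
  have hφc : ∀ w, φ (a * w) = a * φ w := by
    intro w
    have h1 : g (F (G.K w)) = F (g (G.K w)) := DFunLike.congr_fun hc (G.K w)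
    change G.H (g (G.K (a * w))) = a * G.H (g (G.K w))
    rw [← G.map_K, h1, G.H_map (hne w)]
  obtain ⟨c, hcw⟩ := exists_eq_mul_of_commute ha him hφ hφ0 hφc
  have hgK : ∀ w, g (G.K w) = G.K (c * w) := fun w => by
    rw [← hcw w]
    exact (G.K_H _ (hne w)).symm
  have hc0 : c ≠ 0 := by
    rintro rfl
    have h1 : g (G.K 1) = g (G.K 0) := by rw [hgK, hgK]; simp
    exact one_ne_zero (G.K_injective (g.injective h1))
  refine ⟨Units.mk0 c hc0, ?_⟩
  ext1 p
  by_cases hp : p = Q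
  · rw [hp, G.scaling_far, hQ]
  · rw [G.scaling_eq _ hp, Units.val_mk0, ← hgK, G.K_H p hp]

end GlobalChart

/-! ## The centralizer -/

lemma diffGroup_top_le (r : ℕ∞) : diffGroup ⊤ ≤ diffGroup r := fun _ hg =>
  ⟨hg.1.of_le (by exact_mod_cast le_top), hg.2.of_le (by exact_mod_cast le_top)⟩

/-- The parametrization of `ℂˣ = ℝ² ∖ {0}` by the flows of `Z` and `X_{A,0}`. -/
def flowHom (A : Conformal) : Circle × Multiplicative ℝ →* ℂˣ where
  toFun q := Circle.toUnits q.1 * flowUnit A 0 0 q.2.toAdd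
  map_one' := by
    have h := flowUnit_int A 0 0 0
    simp at h
    simp [h]
  map_mul' q q' := by
    have h := flowUnit_mul A 0 0 q.2.toAdd 0 q'.2.toAdd
    rw [add_zero] at h
    simp only [Prod.fst_mul, Prod.snd_mul, map_mul, toAdd_mul, h]
    exact mul_mul_mul_comm _ _ _ _

lemma flowHom_exp (A : Conformal) (s t : ℝ) :
    flowHom A (Circle.exp (2 * Real.pi * s), Multiplicative.ofAdd t) = flowUnit A 0 s t := by
  ext
  simp only [flowHom, MonoidHom.coe_mk, OneHom.coe_mk, Units.val_mul, flowUnit, Units.val_mk0,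
    toAdd_ofAdd, Circle.toUnits_apply, Circle.coe_exp, ← Complex.exp_add]
  congr 1
  push_cast
  ring

lemma flowHom_bijective (A : Conformal) : Function.Bijective (flowHom A) := by
  constructor
  · rw [injective_iff_map_eq_one]
    rintro ⟨z, t⟩ h
    have h1 : (z : ℂ) * flowUnit A 0 0 t.toAdd = 1 := by
      simpa [flowHom] using congrArg Units.val h
    have h2 := congrArg norm h1
    rw [norm_mul, Circle.norm_coe, one_mul, norm_one] at h2
    simp only [flowUnit, Units.val_mk0, Complex.norm_exp] at h2
    have h3 : t.toAdd * Real.log A.ratio = 0 := by simpa using h2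
    have h4 : t.toAdd = 0 := (mul_eq_zero.1 h3).resolve_right (log_ratio_ne_zero A)
    have h5 : (z : ℂ) = 1 := by simpa [h4, flowUnit] using h1
    exact Prod.ext (Circle.ext h5) (Multiplicative.toAdd.injective h4)
  · intro w
    exact ⟨_, (flowHom_exp A _ _).trans (eq_flowUnit A 0 w).symm⟩

section

variable {f : Equiv.Perm S2} {A B : Conformal} {n : ℤ} {κ : ℂˣ}

lemma scaling_flowUnit (G : GlobalChart f north south A.mult)
    (G' : GlobalChart f⁻¹ south north B.mult⁻¹)
    (hκ : ∀ s t : ℝ, G.K (flowUnit A 0 s t) = G'.K (κ * flowUnit B n s t)) (s t : ℝ) (w : ℂ) :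
    G.scaling (flowUnit A 0 s t) (G'.K w) = G'.K (flowUnit B n s t * w) := by
  by_cases hw : w = 0
  · rw [hw, mul_zero, G'.K_zero, G.scaling_far]
  · obtain ⟨s', t', h⟩ : ∃ s' t' : ℝ, κ⁻¹ * Units.mk0 w hw = flowUnit B n s' t' :=
      ⟨_, _, eq_flowUnit B n _⟩
    have hw' : w = κ * flowUnit B n s' t' := by
      have := congrArg Units.val (inv_mul_eq_iff_eq_mul.1 h)
      simpa using this
    rw [hw', ← hκ, G.scaling_K, ← Units.val_mul, ← flowUnit_mul, hκ, flowUnit_mul, Units.val_mul,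
      mul_left_comm]

lemma scaling_mem_diffGroup (G : GlobalChart f north south A.mult)
    (G' : GlobalChart f⁻¹ south north B.mult⁻¹)
    (hκ : ∀ s t : ℝ, G.K (flowUnit A 0 s t) = G'.K (κ * flowUnit B n s t)) (c : ℂˣ) :
    G.scaling c ∈ diffGroup ⊤ := by
  have H : ∀ c : ℂˣ, ContMDiff (𝓡 2) (𝓡 2) ∞ (G.scaling c) := by
    intro c p
    by_cases hp : p = south
    · have hpn : p ≠ north := hp ▸ G.base_ne.symm
      obtain ⟨s, t, hc⟩ : ∃ s t : ℝ, c = flowUnit A 0 s t := ⟨_, _, eq_flowUnit A 0 c⟩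
      refine (G'.contMDiffAt_conj_mul (flowUnit B n s t) hpn).congr_of_eventuallyEq ?_
      filter_upwards [isOpen_ne.mem_nhds hpn] with q hq
      rw [hc, ← scaling_flowUnit G G' hκ, G'.K_H q hq]
    · refine (G.contMDiffAt_conj_mul c hp).congr_of_eventuallyEq ?_
      filter_upwards [isOpen_ne.mem_nhds hp] with q hq
      exact G.scaling_eq c hq
  exact ⟨H c, by simpa using H c⁻¹⟩

/-- The centralizer of `f` is the group generated by the two commuting flows. -/
lemma exists_mulEquiv_diffCentralizer (G : GlobalChart f north south A.mult)
    (G' : GlobalChart f⁻¹ south north B.mult⁻¹) (hA : 1 < ‖A.mult‖) (him : A.mult.im ≠ 0)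
    (hκ : ∀ s t : ℝ, G.K (flowUnit A 0 s t) = G'.K (κ * flowUnit B n s t))
    {r : ℕ∞} (hr : 1 ≤ r) :
    ∃ Φ : Circle × Multiplicative ℝ ≃* diffCentralizer r f,
      ∀ q, (Φ q).1 = G.scaling (flowHom A q) := by
  have hmem : ∀ q, (G.scaling.comp (flowHom A)) q ∈ diffCentralizer r f := fun q =>
    ⟨diffGroup_top_le r (scaling_mem_diffGroup G G' hκ _),
      Subgroup.mem_centralizer_singleton_iff.2 (G.scaling_commute A.mult_ne_zero _)⟩
  refine ⟨MulEquiv.ofBijective ((G.scaling.comp (flowHom A)).codRestrict _ hmem) ⟨?_, ?_⟩,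
    fun q => rfl⟩
  · intro q q' h
    exact (flowHom_bijective A).1 (G.scaling_injective (congrArg Subtype.val h))
  · rintro ⟨g, hg⟩
    obtain ⟨c, hc⟩ := G.exists_scaling_eq hA him (hg.1.1.of_le (by exact_mod_cast hr))
      (Subgroup.mem_centralizer_singleton_iff.1 hg.2)
    obtain ⟨q, rfl⟩ := (flowHom_bijective A).2 c
    exact ⟨q, Subtype.ext hc⟩

end

/-! ## Linear vector fields in the global charts -/

/-- The linear vector field `w ↦ l w` of the plane. -/
def mulField (l : ℂ) (w : ℂ) : TangentSpace 𝓘(ℝ, ℂ) w := (l * w : ℂ)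

lemma contMDiffAt_mulField (l w : ℂ) : ContMDiffAt 𝓘(ℝ, ℂ) 𝓘(ℝ, ℂ).tangent ∞
    (fun w => (⟨w, mulField l w⟩ : TangentBundle 𝓘(ℝ, ℂ) ℂ)) w := by
  rw [contMDiffAt_vectorSpace_iff_contDiffAt]
  exact (contDiff_const.mul contDiff_id).contDiffAt

lemma mlieBracket_mulField (l l' : ℂ) :
    VectorField.mlieBracket 𝓘(ℝ, ℂ) (mulField l) (mulField l') = 0 := by
  refine (VectorField.mlieBracketWithin_eq_lieBracketWithin (V := mulField l) (W := mulField l')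
    (s := Set.univ)).trans ?_
  funext w
  have hd : ∀ l : ℂ, HasFDerivAt (fun w : ℂ => l * w) (ContinuousLinearMap.mul ℝ ℂ l) w :=
    fun l => (ContinuousLinearMap.mul ℝ ℂ l).hasFDerivAt
  change fderivWithin ℝ (fun w : ℂ => l' * w) Set.univ w (l * w)
    - fderivWithin ℝ (fun w : ℂ => l * w) Set.univ w (l' * w) = 0
  rw [fderivWithin_univ, fderivWithin_univ, (hd l).fderiv, (hd l').fderiv,
    ContinuousLinearMap.mul_apply', ContinuousLinearMap.mul_apply']
  ring

lemma isInvertible_of_surjective {L : EuclideanSpace ℝ (Fin 2) →L[ℝ] ℂ}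
    (hs : Function.Surjective L) : L.IsInvertible := by
  have hi : Function.Injective L.toLinearMap :=
    (LinearMap.injective_iff_surjective_of_finrank_eq_finrank (by simp)).2 hs
  exact ⟨(LinearEquiv.ofBijective L.toLinearMap ⟨hi, hs⟩).toContinuousLinearEquiv, rfl⟩

namespace GlobalChart

variable {F : Equiv.Perm S2} {P Q : S2} {a : ℂ}

lemma hasMFDerivAt_K (G : GlobalChart F P Q a) (w : ℂ) :
    HasMFDerivAt 𝓘(ℝ, ℂ) (𝓡 2) G.K w (mfderiv 𝓘(ℝ, ℂ) (𝓡 2) G.K w) :=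
  (G.smooth_K.mdifferentiable (by simp) w).hasMFDerivAt

lemma hasMFDerivAt_H (G : GlobalChart F P Q a) {p : S2} (hp : p ≠ Q) :
    HasMFDerivAt (𝓡 2) 𝓘(ℝ, ℂ) G.H p (mfderiv (𝓡 2) 𝓘(ℝ, ℂ) G.H p) :=
  ((G.smooth_H p hp).mdifferentiableAt (by simp)).hasMFDerivAt

lemma mfderiv_H_mfderiv_K (G : GlobalChart F P Q a) (w v : ℂ) :
    mfderiv (𝓡 2) 𝓘(ℝ, ℂ) G.H (G.K w) (mfderiv 𝓘(ℝ, ℂ) (𝓡 2) G.K w v) = v := by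
  have h1 := (G.hasMFDerivAt_H (G.K_ne w)).comp w (G.hasMFDerivAt_K w)
  have h2 : G.H ∘ G.K = id := funext G.H_K
  rw [h2] at h1
  exact DFunLike.congr_fun (hasMFDerivAt_unique h1 (hasMFDerivAt_id w)) v

lemma isInvertible_mfderiv_H (G : GlobalChart F P Q a) {p : S2} (hp : p ≠ Q) :
    (mfderiv (𝓡 2) 𝓘(ℝ, ℂ) G.H p).IsInvertible := by
  refine isInvertible_of_surjective (L := mfderiv (𝓡 2) 𝓘(ℝ, ℂ) G.H p) fun v => ?_
  have h := G.mfderiv_H_mfderiv_K (G.H p) v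
  rw [G.K_H p hp] at h
  exact ⟨_, h⟩

/-- The vector field on the complement of `Q` which in the chart is `w ↦ l w`. -/
def linearField (G : GlobalChart F P Q a) (l : ℂ) : (p : S2) → TangentSpace (𝓡 2) p :=
  VectorField.mpullback (𝓡 2) 𝓘(ℝ, ℂ) G.H (mulField l)

lemma mfderiv_H_linearField (G : GlobalChart F P Q a) (l : ℂ) {p : S2} (hp : p ≠ Q) :
    mfderiv (𝓡 2) 𝓘(ℝ, ℂ) G.H p (G.linearField l p) = mulField l (G.H p) :=
  (G.isInvertible_mfderiv_H hp).self_apply_inverse _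

lemma eq_of_mfderiv_H_eq (G : GlobalChart F P Q a) {p : S2} (hp : p ≠ Q)
    {v v' : TangentSpace (𝓡 2) p}
    (h : mfderiv (𝓡 2) 𝓘(ℝ, ℂ) G.H p v = mfderiv (𝓡 2) 𝓘(ℝ, ℂ) G.H p v') : v = v' :=
  (G.isInvertible_mfderiv_H hp).injective h

lemma linearField_base (G : GlobalChart F P Q a) (l : ℂ) : G.linearField l P = 0 := by
  apply G.eq_of_mfderiv_H_eq G.base_ne
  rw [G.mfderiv_H_linearField l G.base_ne, map_zero, mulField, G.H_base, mul_zero]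
  rfl

lemma contMDiffAt_linearField (G : GlobalChart F P Q a) (l : ℂ) {p : S2} (hp : p ≠ Q) :
    ContMDiffAt (𝓡 2) (𝓡 2).tangent ∞
      (fun p => (⟨p, G.linearField l p⟩ : TangentBundle (𝓡 2) S2)) p :=
  ContMDiffAt.mpullback_vectorField_preimage (contMDiffAt_mulField l _) (G.smooth_H p hp)
    (G.isInvertible_mfderiv_H hp) (by simp)

lemma mlieBracket_linearField (G : GlobalChart F P Q a) (l l' : ℂ) {p : S2} (hp : p ≠ Q) :
    VectorField.mlieBracket (𝓡 2) (G.linearField l) (G.linearField l') p = 0 := by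
  have hd : ∀ l : ℂ, MDifferentiableAt 𝓘(ℝ, ℂ) 𝓘(ℝ, ℂ).tangent
      (fun w => (⟨w, mulField l w⟩ : TangentBundle 𝓘(ℝ, ℂ) ℂ)) (G.H p) := fun l =>
    (contMDiffAt_mulField l _).mdifferentiableAt (by simp)
  rw [linearField, linearField, ← VectorField.mpullback_mlieBracket (n := ∞) (hd l) (hd l')
    (G.smooth_H p hp) (by simpa using ENat.LEInfty.out), mlieBracket_mulField,
    VectorField.mpullback_zero]
  rfl

lemma mfderiv_K_mulField (G : GlobalChart F P Q a) (l w : ℂ) :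
    mfderiv 𝓘(ℝ, ℂ) (𝓡 2) G.K w (mulField l w) = G.linearField l (G.K w) := by
  apply G.eq_of_mfderiv_H_eq (G.K_ne w)
  refine (G.mfderiv_H_mfderiv_K w _).trans ?_
  rw [G.mfderiv_H_linearField l (G.K_ne w), mulField, mulField, G.H_K]

lemma hasMFDerivAt_exp_curve (G : GlobalChart F P Q a) (l w : ℂ) (t : ℝ) :
    HasMFDerivAt 𝓘(ℝ, ℝ) (𝓡 2) (fun t : ℝ => G.K (Complex.exp (t * l) * w)) t
      ((1 : ℝ →L[ℝ] ℝ).smulRight (G.linearField l (G.K (Complex.exp (t * l) * w)))) := by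
  have h1 : HasDerivAt (fun t : ℝ => Complex.exp (t * l) * w)
      (l * (Complex.exp (t * l) * w)) t := by
    have h2 : HasDerivAt (fun t : ℝ => (t : ℂ) * l) l t := by
      simpa using (Complex.ofRealCLM.hasDerivAt (x := t)).mul_const l
    convert! (h2.cexp.mul_const w) using 1
    ring
  have h3 := (G.hasMFDerivAt_K (Complex.exp (t * l) * w)).comp t h1.hasFDerivAt.hasMFDerivAt
  refine h3.congr_mfderiv (ContinuousLinearMap.ext fun r => ?_)
  rw [← G.mfderiv_K_mulField]
  let L : ℂ →L[ℝ] EuclideanSpace ℝ (Fin 2) :=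
    mfderiv 𝓘(ℝ, ℂ) (𝓡 2) G.K (Complex.exp (t * l) * w)
  exact L.map_smul (show ℝ from r) (l * (Complex.exp (t * l) * w))

open Classical in
/-- The vector field of the sphere which in the chart is `w ↦ l w` and which vanishes at `Q`. -/
def field (G : GlobalChart F P Q a) (l : ℂ) (p : S2) : TangentSpace (𝓡 2) p :=
  if p = Q then 0 else G.linearField l p

lemma field_of_ne (G : GlobalChart F P Q a) (l : ℂ) {p : S2} (hp : p ≠ Q) :
    G.field l p = G.linearField l p := if_neg hp

lemma field_far (G : GlobalChart F P Q a) (l : ℂ) : G.field l Q = 0 := if_pos rfl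

lemma field_eventuallyEq (G : GlobalChart F P Q a) (l : ℂ) {p : S2} (hp : p ≠ Q) :
    ∀ᶠ q in 𝓝 p, G.field l q = G.linearField l q := by
  filter_upwards [isOpen_ne.mem_nhds hp] with q hq using G.field_of_ne l hq

lemma preserves_field (G : GlobalChart F P Q a) (ha : a ≠ 0) (hF : ContMDiff (𝓡 2) (𝓡 2) 1 F)
    (l : ℂ) : Preserves F (G.field l) := by
  intro p
  by_cases hp : p = Q
  · subst hp
    rw [G.field_far, map_zero, G.map_far ha, G.field_far]
  have hFp := G.map_ne hp
  rw [G.field_of_ne l hp, G.field_of_ne l hFp]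
  apply G.eq_of_mfderiv_H_eq hFp
  rw [G.mfderiv_H_linearField l hFp]
  have h1 := (G.hasMFDerivAt_H hFp).comp p (hF.mdifferentiable one_ne_zero p).hasMFDerivAt
  have hm : HasMFDerivAt 𝓘(ℝ, ℂ) 𝓘(ℝ, ℂ) (fun w : ℂ => a * w) (G.H p)
      (ContinuousLinearMap.mul ℝ ℂ a) :=
    (ContinuousLinearMap.mul ℝ ℂ a).hasFDerivAt.hasMFDerivAt
  have h2 := hm.comp p (G.hasMFDerivAt_H hp)
  have h3 : G.H ∘ F =ᶠ[𝓝 p] (fun w => a * w) ∘ G.H := by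
    filter_upwards [isOpen_ne.mem_nhds hp] with q hq using G.H_map hq
  have h4 := DFunLike.congr_fun (hasMFDerivAt_unique h1 (h2.congr_of_eventuallyEq h3))
    (G.linearField l p)
  refine (Eq.trans h4 (congrArg (fun v : ℂ => a * v) (G.mfderiv_H_linearField l hp))).trans ?_
  rw [mulField, mulField, G.H_map hp, mul_left_comm]

lemma agreesNear_linearField (G : GlobalChart F P Q a) (l : ℂ) :
    AgreesNear (G.linearField l) (fun w => l * w) P := by
  filter_upwards [G.H_near.eventually_nhds, isOpen_ne.mem_nhds G.base_ne] with p hp hQ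
  have h1 : G.H =ᶠ[𝓝 p] xy := hp
  have h2 := G.mfderiv_H_linearField l hQ
  rw [h1.mfderiv_eq, mulField, h1.eq_of_nhds] at h2
  exact h2

end GlobalChart

lemma AgreesNear.congr {V W : (p : S2) → TangentSpace (𝓡 2) p} {v : ℂ → ℂ} {P : S2}
    (h : AgreesNear V v P) (hVW : ∀ᶠ p in 𝓝 P, W p = V p) : AgreesNear W v P := by
  filter_upwards [h, hVW] with p hp hVp
  rw [hVp, hp]

/-! ## The invariant fields and their flows -/

namespace GlobalChart

variable {F F' : Equiv.Perm S2} {P Q : S2} {a a' : ℂ}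

/-- If the transition between two charts around `P` and `Q` carries the flow of `w ↦ l w` to the
flow of `w ↦ l' w`, then these two fields of the charts agree. -/
lemma field_eq_linearField (G : GlobalChart F P Q a) (G' : GlobalChart F' Q P a') {l l' : ℂ}
    (h : ∀ (t : ℝ) (w : ℂ), w ≠ 0 →
      G.K (Complex.exp (t * l) * w) = G'.K (Complex.exp (t * l') * G'.H (G.K w)))
    {p : S2} (hp : p ≠ P) : G.field l p = G'.linearField l' p := by
  by_cases hQ : p = Q
  · subst hQ
    rw [G.field_far, G'.linearField_base]
  obtain ⟨w, rfl⟩ : ∃ w, G.K w = p := ⟨_, G.K_H p hQ⟩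
  have hw : w ≠ 0 := fun h0 => hp (by rw [h0, G.K_zero])
  rw [G.field_of_ne l hQ]
  have h1 := G.hasMFDerivAt_exp_curve l w 0
  have h2 := G'.hasMFDerivAt_exp_curve l' (G'.H (G.K w)) 0
  have h3 : (fun t : ℝ => G.K (Complex.exp (t * l) * w))
      = fun t : ℝ => G'.K (Complex.exp (t * l') * G'.H (G.K w)) := funext fun t => h t w hw
  rw [h3] at h1
  have h4 := DFunLike.congr_fun (hasMFDerivAt_unique h1 h2) (1 : ℝ)
  have h5 : G.K (Complex.exp ((0 : ℝ) * l) * w) = G.K w := by simp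
  have h6 : G'.K (Complex.exp ((0 : ℝ) * l') * G'.H (G.K w)) = G.K w := by
    rw [← h 0 w hw, h5]
  have h7 : (1 : ℝ) • G.linearField l (G.K (Complex.exp ((0 : ℝ) * l) * w))
      = (1 : ℝ) • G'.linearField l' (G'.K (Complex.exp ((0 : ℝ) * l') * G'.H (G.K w))) := h4
  rw [h5, h6, one_smul, one_smul] at h7
  exact h7

section

variable (G : GlobalChart F P Q a) (G' : GlobalChart F' Q P a') {l l' m m' : ℂ}

lemma smoothField_field (h : ∀ p, p ≠ P → G.field l p = G'.linearField l' p) :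
    SmoothField (G.field l) := by
  intro p
  by_cases hp : p = Q
  · have hP : p ≠ P := hp ▸ G.base_ne.symm
    refine (G'.contMDiffAt_linearField l' hP).congr_of_eventuallyEq ?_
    filter_upwards [isOpen_ne.mem_nhds hP] with q hq
    rw [h q hq]
  · refine (G.contMDiffAt_linearField l hp).congr_of_eventuallyEq ?_
    filter_upwards [G.field_eventuallyEq l hp] with q hq
    rw [hq]

lemma mlieBracket_field (h : ∀ p, p ≠ P → G.field l p = G'.linearField l' p)
    (h' : ∀ p, p ≠ P → G.field m p = G'.linearField m' p) (p : S2) :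
    VectorField.mlieBracket (𝓡 2) (G.field l) (G.field m) p = 0 := by
  by_cases hp : p = Q
  · have hP : p ≠ P := hp ▸ G.base_ne.symm
    rw [Filter.EventuallyEq.mlieBracket_vectorField_eq
      ((isOpen_ne.eventually_mem hP).mono fun q hq => h q hq)
      ((isOpen_ne.eventually_mem hP).mono fun q hq => h' q hq)]
    exact G'.mlieBracket_linearField l' m' hP
  · rw [Filter.EventuallyEq.mlieBracket_vectorField_eq (G.field_eventuallyEq l hp)
      (G.field_eventuallyEq m hp)]
    exact G.mlieBracket_linearField l m hp

end

lemma linearIndependent_field (G : GlobalChart F P Q a) {l m : ℂ}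
    (h : ∀ s t : ℝ, s * l + t * m = 0 → s = 0 ∧ t = 0) {p : S2} (hP : p ≠ P) (hQ : p ≠ Q) :
    LinearIndependent ℝ ![G.field l p, G.field m p] := by
  rw [G.field_of_ne l hQ, G.field_of_ne m hQ, LinearIndependent.pair_iff]
  intro s t hst
  let L : TangentSpace (𝓡 2) p →L[ℝ] ℂ := mfderiv (𝓡 2) 𝓘(ℝ, ℂ) G.H p
  have h1 := congrArg L hst
  have hl : L (G.linearField l p) = l * G.H p := G.mfderiv_H_linearField l hQ
  have hm : L (G.linearField m p) = m * G.H p := G.mfderiv_H_linearField m hQ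
  rw [map_add, map_smul, map_smul, map_zero, hl, hm, Complex.real_smul, Complex.real_smul] at h1
  apply h
  apply mul_right_cancel₀ (G.H_ne_zero hP hQ)
  linear_combination h1

lemma isMIntegralCurve_scaling (G : GlobalChart F P Q a) {l : ℂ} {c : ℝ → ℂˣ}
    (hc : ∀ t, (c t : ℂ) = Complex.exp (t * l)) (p : S2) :
    IsMIntegralCurve (fun t => G.scaling (c t) p) (G.field l) := by
  intro t
  by_cases hp : p = Q
  · have h1 : (fun t => G.scaling (c t) p) = fun _ => p := by
      funext t
      rw [hp, G.scaling_far]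
    rw [h1]
    refine (hasMFDerivAt_const p t).congr_mfderiv ?_
    change 0 = (1 : ℝ →L[ℝ] ℝ).smulRight (G.field l p)
    rw [hp, G.field_far]
    ext
    simp
  · have h1 : (fun t => G.scaling (c t) p) = fun t : ℝ => G.K (Complex.exp (t * l) * G.H p) := by
      funext t
      rw [G.scaling_eq _ hp, hc]
    rw [h1]
    refine (G.hasMFDerivAt_exp_curve l (G.H p) t).congr_mfderiv ?_
    change _ = (1 : ℝ →L[ℝ] ℝ).smulRight (G.field l (G.K (Complex.exp (t * l) * G.H p)))
    rw [G.field_of_ne l (G.K_ne _)]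

end GlobalChart

/-! ## Existence of the global charts -/

section

variable {f : Equiv.Perm S2} {A B : Conformal}

lemma IsDAB.mult_expanding (hf : IsDAB f A B) :
    1 < ‖A.mult‖ ∧ A.mult.im ≠ 0 := by
  have hN := hf.northSouth
  have hfix : f (pole 1) = pole 1 := by rw [pole_one]; exact hN.fixed_source
  have hev : ∀ᶠ p in 𝓝 (pole 1), xy (f p) = A.mult * xy p := by rw [pole_one]; exact hf.near_north
  constructor
  · exact hN.source _ (pole_one ▸ mem_derivEigenvalues hN.diffeo.1 hfix hev)
  · refine im_ne_zero_of_derivEigenvalues hN.diffeo.1 hfix hev ?_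
    rw [pole_one]
    exact hN.source_nonreal

lemma IsDAB.mult_contracting (hf : IsDAB f A B) : ‖B.mult‖ < 1 := by
  have hN := hf.northSouth
  have hfix : f (pole (-1)) = pole (-1) := by rw [pole_neg_one]; exact hN.fixed_sink
  have hev : ∀ᶠ p in 𝓝 (pole (-1)), xy (f p) = B.mult * xy p := by
    rw [pole_neg_one]; exact hf.near_south
  exact hN.sink _ (pole_neg_one ▸ mem_derivEigenvalues hN.diffeo.1 hfix hev)

lemma one_lt_norm_inv {b : ℂ} (hb : b ≠ 0) (h : ‖b‖ < 1) : 1 < ‖b⁻¹‖ := by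
  rw [norm_inv]
  exact (one_lt_inv₀ (norm_pos_iff.2 hb)).2 h

lemma IsDAB.exists_globalCharts (hf : IsDAB f A B) (hsmooth : f ∈ diffGroup ⊤) :
    Nonempty (GlobalChart f north south A.mult) ∧
      Nonempty (GlobalChart f⁻¹ south north B.mult⁻¹) := by
  have hN := hf.northSouth
  have hA := hf.mult_expanding.1
  have hB := hf.mult_contracting
  have hB' := one_lt_norm_inv B.mult_ne_zero hB
  have hA' : ‖A.mult⁻¹‖ < 1 := by rw [norm_inv]; exact inv_lt_one_of_one_lt₀ hA
  have hcont : Continuous f := hsmooth.1.continuous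
  have hcont' : Continuous f.symm := hsmooth.2.continuous
  have hn : pole (- -1) = north := by rw [neg_neg, pole_one]
  have hfixN : f⁻¹ north = north := (Equiv.symm_apply_eq f).2 hN.fixed_source.symm
  have hfixS : f⁻¹ south = south := (Equiv.symm_apply_eq f).2 hN.fixed_sink.symm
  obtain ⟨δ₁, h₁⟩ : ∃ δ, LinearOnCap f 1 A.mult δ :=
    exists_linearOnCap hcont (by rw [pole_one, hN.fixed_source])
      (by rw [pole_one]; exact hf.near_north)
  obtain ⟨δ₂, h₂⟩ : ∃ δ, LinearOnCap f (-1) B.mult δ :=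
    exists_linearOnCap hcont (by rw [pole_neg_one, hN.fixed_sink])
      (by rw [pole_neg_one]; exact hf.near_south)
  obtain ⟨δ₃, h₃⟩ : ∃ δ, LinearOnCap f⁻¹ (-1) B.mult⁻¹ δ :=
    exists_linearOnCap hcont' (by rw [pole_neg_one, hfixS])
      (by
        rw [pole_neg_one]
        exact eventually_xy_inv B.mult_ne_zero hcont' hN.fixed_sink hf.near_south)
  obtain ⟨δ₄, h₄⟩ : ∃ δ, LinearOnCap f⁻¹ (- -1) A.mult⁻¹ δ :=
    exists_linearOnCap hcont' (by rw [hn, hfixN])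
      (by rw [hn]; exact eventually_xy_inv A.mult_ne_zero hcont' hN.fixed_source hf.near_north)
  have hlim : ∀ p, p ≠ north → Tendsto (fun m : ℕ => (f ^ m) p) atTop (𝓝 south) := by
    intro p hp
    rw [← pole_neg_one]
    refine tendsto_pole_neg h₁ hA h₂ hB ?_ (by rwa [pole_one])
    rw [hN.nonwandering, pole_one, pole_neg_one]
  have hlim' : ∀ p, p ≠ south → Tendsto (fun m : ℕ => (f⁻¹ ^ m) p) atTop (𝓝 north) := by
    intro p hp
    rw [← hn]
    refine tendsto_pole_neg h₃ hB' h₄ hA' ?_ (by rwa [pole_neg_one])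
    rw [nonwanderingSet_inv, hN.nonwandering, hn, pole_neg_one, Set.pair_comm]
  constructor
  · have := h₁.nonempty_globalChart hA hsmooth (by rw [pole_neg_one, hN.fixed_sink])
      (by rw [pole_neg_one, pole_one]; exact hlim')
    rwa [pole_neg_one, pole_one] at this
  · have := h₃.nonempty_globalChart hB' (inv_mem hsmooth) (by rw [hn, hfixN])
      (by rw [hn, pole_neg_one, inv_inv]; exact hlim)
    rwa [hn, pole_neg_one] at this

end

lemma flowUnit_zero_right (A : Conformal) (n : ℤ) (s : ℝ) :
    (flowUnit A n s 0 : ℂ) = Complex.exp (s * (2 * Real.pi * Complex.I)) := by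
  simp only [flowUnit, Units.val_mk0]
  congr 1
  push_cast
  ring

lemma flowUnit_zero_left (A : Conformal) (n : ℤ) (t : ℝ) :
    (flowUnit A n 0 t : ℂ)
      = Complex.exp (t * (Real.log A.ratio + (A.angle + 2 * Real.pi * n) * Complex.I)) := by
  simp only [flowUnit, Units.val_mk0]
  congr 1
  push_cast
  ring

lemma eq_zero_of_combination_eq_zero {r θ : ℝ} (hr : r ≠ 0) (s t : ℝ)
    (h : (s : ℂ) * (2 * Real.pi * Complex.I) + t * (r + θ * Complex.I) = 0) : s = 0 ∧ t = 0 := by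
  have hre := congrArg Complex.re h
  have him := congrArg Complex.im h
  simp at hre him
  have ht : t = 0 := hre.resolve_right hr
  rw [ht, zero_mul, add_zero] at him
  have hpi := Real.pi_ne_zero
  exact ⟨by simpa [hpi] using him, ht⟩

end

end MatherSphere

theorem mainTheorem8 (A B : Conformal) (n : ℤ) (f : Equiv.Perm S2)
    (hsmooth : f ∈ diffGroup ⊤)
    (hf : IsDABn f A B n)
    (htrans : IsTranslation (matherInvariant f A B n)) :
    ∃ Z X : (p : S2) → TangentSpace (𝓡 2) p,
      SmoothField Z ∧ SmoothField X ∧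
      Preserves f Z ∧ Preserves f X ∧
      (∀ p, VectorField.mlieBracket (𝓡 2) Z X p = 0) ∧
      (∀ p, p ≠ north → p ≠ south → LinearIndependent ℝ ![Z p, X p]) ∧
      AgreesNear Z fieldZ north ∧
      AgreesNear Z fieldZ south ∧
      AgreesNear X (fieldX A 0) north ∧
      AgreesNear X (fieldX B n) south ∧
      ∀ r : ℕ∞, 1 ≤ r →
        ∃ Φ : Circle × Multiplicative ℝ ≃* diffCentralizer r f,
          (∀ p, IsMIntegralCurve
            (fun s : ℝ => (Φ (Circle.exp (2 * Real.pi * s), 1)).1 p) Z) ∧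
          (∀ p, IsMIntegralCurve
            (fun t : ℝ => (Φ (1, Multiplicative.ofAdd t)).1 p) X) := by
  have hA := hf.isDAB.mult_expanding.1
  have hB := one_lt_norm_inv B.mult_ne_zero hf.isDAB.mult_contracting
  obtain ⟨⟨G⟩, ⟨G'⟩⟩ := hf.isDAB.exists_globalCharts hsmooth
  obtain ⟨κ, hκ⟩ := exists_transition G G' hA hB htrans
  have hdiff := hf.isDAB.northSouth.diffeo.1
  let lZ : ℂ := 2 * Real.pi * Complex.I
  let lA : ℂ := Real.log A.ratio + (A.angle + 2 * Real.pi * (0 : ℤ)) * Complex.I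
  let lB : ℂ := Real.log B.ratio + (B.angle + 2 * Real.pi * n) * Complex.I
  have hflow : ∀ (s t : ℝ) (w : ℂ), w ≠ 0 → G.K (flowUnit A 0 s t * w)
      = G'.K (flowUnit B n s t * G'.H (G.K w)) := by
    intro s t w hw
    rw [← scaling_flowUnit G G' hκ, G'.K_H _ (G.K_ne_base hw), G.scaling_K]
  have hZ : ∀ p, p ≠ north → G.field lZ p = G'.linearField lZ p := fun p hp =>
    G.field_eq_linearField G' (fun s w hw => by
      rw [← flowUnit_zero_right A 0, hflow s 0 w hw, flowUnit_zero_right A 0,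
        flowUnit_zero_right B n]) hp
  have hX : ∀ p, p ≠ north → G.field lA p = G'.linearField lB p := fun p hp =>
    G.field_eq_linearField G' (fun t w hw => by
      rw [← flowUnit_zero_left A 0, hflow 0 t w hw, flowUnit_zero_left]) hp
  have hS : ∀ᶠ p in 𝓝 south, p ≠ north := isOpen_ne.mem_nhds G'.base_ne
  refine ⟨G.field lZ, G.field lA, G.smoothField_field G' hZ, G.smoothField_field G' hX,
    G.preserves_field A.mult_ne_zero hdiff lZ, G.preserves_field A.mult_ne_zero hdiff lA,
    G.mlieBracket_field G' hZ hX, fun p hN hS => G.linearIndependent_field ?_ hN hS,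
    (G.agreesNear_linearField lZ).congr (G.field_eventuallyEq lZ G.base_ne),
    (G'.agreesNear_linearField lZ).congr (hS.mono hZ),
    (G.agreesNear_linearField lA).congr (G.field_eventuallyEq lA G.base_ne),
    (G'.agreesNear_linearField lB).congr (hS.mono hX), fun r hr => ?_⟩
  · intro s t h
    refine eq_zero_of_combination_eq_zero (r := Real.log A.ratio)
      (θ := A.angle + 2 * Real.pi * (0 : ℤ)) (log_ratio_ne_zero A) s t ?_
    push_cast
    simpa [lZ, lA] using h
  · obtain ⟨Φ, hΦ⟩ := exists_mulEquiv_diffCentralizer G G' hA hf.isDAB.mult_expanding.2 hκ hr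
    refine ⟨Φ, fun p => ?_, fun p => ?_⟩
    · have h1 := G.isMIntegralCurve_scaling (flowUnit_zero_right A 0) p
      have h2 : ∀ s : ℝ, (Φ (Circle.exp (2 * Real.pi * s), 1)).1 = G.scaling (flowUnit A 0 s 0) :=
        fun s => by rw [hΦ, ← flowHom_exp, ofAdd_zero]
      simpa only [h2] using h1
    · have h1 := G.isMIntegralCurve_scaling (flowUnit_zero_left A 0) p
      have h2 : ∀ t : ℝ, (Φ (1, Multiplicative.ofAdd t)).1 = G.scaling (flowUnit A 0 0 t) :=
        fun t => by rw [hΦ, ← flowHom_exp, mul_zero, Circle.exp_zero]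
      simpa only [h2] using h1
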